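/- Let $n>2$ and let $\Omega\subset\mathbb R^n$ be a bounded open set with Lebesgue measure $|\Omega|$. Let $a:\Omega\times\mathbb R\to\mathbb R$ be a Carathéodory function (measurable in $x$ for every $s$, continuous in $s$ for almost every $x$) such that, for some constants $\alpha,\beta>0$ and $\theta\ge 0$, $$\frac{\alpha}{(1+|s|)^\theta\ln^\theta(e+|s|)}\le a(x,s)\le\beta\qquad\text{for a.e. }x\in\Omega\text{ and every }s\in\mathbb R .$$ For $m>0$ let $L_w^m(\Omega)$ be the Marcinkiewicz space of all measurable $f$ on $\Omega$ for which there is a constant $\gamma$ with $|\{x\in\Omega:|f(x)|>t\}|\le\gamma t^{-m}$ for all $t>0$, and let $\|f\|_{L_w^m(\Omega)}^m$ be the infimum of all such $\gamma>0$. Let $f\in L_w^m(\Omega)$ with $m>(2^*)'=\frac{2n}{n+2}$, and let $u\in W_0^{1,2}(\Omega)$ be a weak solution of $-\mathrm{div}(a(x,u)Du)=f$ in $\Omega$, $u=0$ on $\partial\Omega$, that is, $$\int_\Omega a(x,u)\,Du\cdot Dv\,dx=\int_\Omega f v\,dx\qquad\text{for all }v\in W_0^{1,2}(\Omega).$$ Let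 $\mu\ge 1$ be any constant such that the function $g(t)=t\ln(e+t)$ satisfies $g(\lambda t)\le\lambda^\mu g(t)$ for all $\lambda>1$ and $t>0$ (for example $\mu=2$). Then: (i) If $m>\frac n2$ and $0\le\theta<1$, there is a constant $L>0$, depending only on $n,\alpha,\beta,\mu,\|f\|_{L_w^m(\Omega)},m$ and $|\Omega|$, such that $|u|\le 2L$ a.e. in $\Omega$. (ii) If $m=\frac n2$ and $0\le\mu\theta<1$, there is a constant $\lambda>0$, depending only on $n,\alpha,\|f\|_{L_w^m(\Omega)},m,\theta$ and $\mu$, such that $e^{\lambda|u|^\rho}\in L^1(\Omega)$ for every $\rho$ with $0<\rho<1-\theta$. (iii) If $(2^*)'<m<\frac n2$ and $0\le\theta<1$, then $|u|\ln(e+|u|)\in L_w^{\varrho}(\Omega)$ for every $\varrho$ with $0<\varrho<\frac{nm}{n-2m}(1-\theta)=m^{**}(1-\theta)$. -/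

import Mathlib

open MeasureTheory Filter Topology

noncomputable section

namespace DegenerateElliptic

/-- The test functions `C_c^∞(Ω)`: smooth functions with compact support contained in `Ω`. -/
def IsTestFunction {n : ℕ} (Ω : Set (EuclideanSpace ℝ (Fin n)))
    (φ : EuclideanSpace ℝ (Fin n) → ℝ) : Prop :=
  ContDiff ℝ (⊤ : ℕ∞) φ ∧ HasCompactSupport φ ∧ tsupport φ ⊆ Ω

/-- `u ∈ W^{1,2}(Ω)` and `Du` is its weak gradient: `u` and `Du` are square integrable on `Ω`, and
`∫_Ω u ∇φ = - ∫_Ω φ Du` for all test functions `φ`. -/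
structure HasW12Gradient {n : ℕ} (Ω : Set (EuclideanSpace ℝ (Fin n)))
    (u : EuclideanSpace ℝ (Fin n) → ℝ)
    (Du : EuclideanSpace ℝ (Fin n) → EuclideanSpace ℝ (Fin n)) : Prop where
  memLp : MemLp u 2 (volume.restrict Ω)
  memLp_grad : MemLp Du 2 (volume.restrict Ω)
  integral_eq : ∀ φ : EuclideanSpace ℝ (Fin n) → ℝ, IsTestFunction Ω φ →
    ∫ x in Ω, u x • gradient φ x = - ∫ x in Ω, φ x • Du x

/-- `u ∈ W_0^{1,2}(Ω)` with weak gradient `Du`: `u ∈ W^{1,2}(Ω)` is the limit, in the norm of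
`W^{1,2}(Ω)`, of a sequence of test functions. -/
structure HasW012Gradient {n : ℕ} (Ω : Set (EuclideanSpace ℝ (Fin n)))
    (u : EuclideanSpace ℝ (Fin n) → ℝ)
    (Du : EuclideanSpace ℝ (Fin n) → EuclideanSpace ℝ (Fin n)) : Prop where
  hasW12Gradient : HasW12Gradient Ω u Du
  exists_approx : ∃ φ : ℕ → EuclideanSpace ℝ (Fin n) → ℝ,
    (∀ k, IsTestFunction Ω (φ k)) ∧
    Tendsto (fun k => eLpNorm (fun x => φ k x - u x) 2 (volume.restrict Ω)) atTop (𝓝 0) ∧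
    Tendsto (fun k => eLpNorm (fun x => gradient (φ k) x - Du x) 2 (volume.restrict Ω))
      atTop (𝓝 0)

/-- `a : Ω × ℝ → ℝ` is a Carathéodory function. Lebesgue measurability on `Ω` is a.e.-measurability
for the restricted Lebesgue measure. -/
structure IsCaratheodory {n : ℕ} (Ω : Set (EuclideanSpace ℝ (Fin n)))
    (a : EuclideanSpace ℝ (Fin n) → ℝ → ℝ) : Prop where
  aemeasurable : ∀ s : ℝ, AEMeasurable (fun x => a x s) (volume.restrict Ω)
  continuous : ∀ᵐ x ∂(volume.restrict Ω), Continuous (a x)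

/-- `α / ((1 + |s|)^θ ln^θ(e + |s|)) ≤ a(x, s) ≤ β` for a.e. `x ∈ Ω` and all `s`. -/
def DegenerateBounds {n : ℕ} (Ω : Set (EuclideanSpace ℝ (Fin n))) (α β θ : ℝ)
    (a : EuclideanSpace ℝ (Fin n) → ℝ → ℝ) : Prop :=
  ∀ᵐ x ∂(volume.restrict Ω), ∀ s : ℝ,
    α / ((1 + |s|) ^ θ * Real.log (Real.exp 1 + |s|) ^ θ) ≤ a x s ∧ a x s ≤ β

/-- `|{x ∈ Ω : |f(x)| > t}| ≤ γ / t^m` for all `t > 0`. -/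
def WeakBound {n : ℕ} (m : ℝ) (Ω : Set (EuclideanSpace ℝ (Fin n)))
    (f : EuclideanSpace ℝ (Fin n) → ℝ) (γ : ℝ) : Prop :=
  ∀ t : ℝ, 0 < t → volume {x | x ∈ Ω ∧ t < |f x|} ≤ ENNReal.ofReal (γ / t ^ m)

/-- The Marcinkiewicz space `L_w^m(Ω)`. -/
def MemWeakL {n : ℕ} (m : ℝ) (Ω : Set (EuclideanSpace ℝ (Fin n)))
    (f : EuclideanSpace ℝ (Fin n) → ℝ) : Prop :=
  AEMeasurable f (volume.restrict Ω) ∧ ∃ γ : ℝ, WeakBound m Ω f γ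

/-- `‖f‖_{L_w^m(Ω)}`, whose `m`-th power is the infimum of the constants `γ > 0` in the defining
inequality of `L_w^m(Ω)`; meaningful for `f ∈ L_w^m(Ω)`. -/
def weakNorm {n : ℕ} (m : ℝ) (Ω : Set (EuclideanSpace ℝ (Fin n)))
    (f : EuclideanSpace ℝ (Fin n) → ℝ) : ℝ :=
  (sInf {γ : ℝ | 0 < γ ∧ WeakBound m Ω f γ}) ^ (1 / m)

/-- `u ∈ W_0^{1,2}(Ω)` is a weak solution of `-div(a(x, u) Du) = f` in `Ω`, `u = 0` on `∂Ω`.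
(The weak gradients `Du`, `Dv` are determined almost everywhere in `Ω`.) -/
def IsWeakSolution {n : ℕ} (Ω : Set (EuclideanSpace ℝ (Fin n)))
    (a : EuclideanSpace ℝ (Fin n) → ℝ → ℝ) (f u : EuclideanSpace ℝ (Fin n) → ℝ) : Prop :=
  ∃ Du : EuclideanSpace ℝ (Fin n) → EuclideanSpace ℝ (Fin n),
    HasW012Gradient Ω u Du ∧
    ∀ (v : EuclideanSpace ℝ (Fin n) → ℝ)
      (Dv : EuclideanSpace ℝ (Fin n) → EuclideanSpace ℝ (Fin n)),
      HasW012Gradient Ω v Dv →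
      ∫ x in Ω, a x (u x) * inner ℝ (Du x) (Dv x) = ∫ x in Ω, f x * v x

/-- The function `g(t) = t ln(e + t)`. -/
def gLog (t : ℝ) : ℝ := t * Real.log (Real.exp 1 + t)

/-- `μ ≥ 1` and `g(λ t) ≤ λ^μ g(t)` for all `λ > 1` and `t > 0`, where `g(t) = t ln(e + t)`. -/
def IsGrowthExponent (μ : ℝ) : Prop :=
  1 ≤ μ ∧ ∀ l : ℝ, 1 < l → ∀ t : ℝ, 0 < t → gLog (l * t) ≤ l ^ μ * gLog t

end DegenerateElliptic

end

/-! The degeneracy is removed by a change of unknown. Let `G` be smooth and nondecreasing with `G 0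
= 0` and `G' ≤ K / w`, where `w(s) = (1 + |s|)^θ ln^θ(e + |s|)`. Then `G' ≤ (K/α) a(x, ·)`, so
testing the equation with a function of `G(u)` controls its unweighted Dirichlet energy. Testing
with an odd cutoff of `G(u)` that climbs from 0 to ±1 between the levels `k` and `k + δ` bounds this
energy by a multiple of `δ⁻¹ ∫ |f|` over `{|G(u)| > k}`. The Marcinkiewicz bound turns the integral
into the power `1 - 1/m` of the measure of that set, and Sobolev's inequality with Chebyshev's
gives, for `φ(t) = |{|G(u)| > t}|` and `q = n/(n - 2)`, the decay `φ(k + δ) ≤ D δ^{-q} φ(k)^{(1 -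
1/m) q}` (`exists_levelDecay`). The exponent `(1 - 1/m) q` is above, equal to or below 1 exactly as
`m` is above, equal to or below `n/2`. The three cases of Stampacchia's lemma then give vanishing,
exponential decay or power decay of `φ`. It remains to choose `G`. For boundedness, `arsinh ∘
arsinh` is unbounded and its derivative is admissible for all `θ ≤ 1` with one `K`, so the bound
does not depend on `θ`. In the other regimes `G(s) = s (1 + s²)^{-τ/2}` with `θ < τ < 1` grows like
`|s|^{1-τ}`; the gap `τ - θ` absorbs the logarithm in `w`, and the strict inequalities on the target
exponents leave room for it. -/

namespace DegenerateElliptic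

/-! ### Gradients of test functions and integration by parts -/

section Sobolev

variable {n : ℕ} {Ω : Set (EuclideanSpace ℝ (Fin n))}

theorem norm_gradient_eq_norm_fderiv (φ : EuclideanSpace ℝ (Fin n) → ℝ)
    (x : EuclideanSpace ℝ (Fin n)) : ‖gradient φ x‖ = ‖fderiv ℝ φ x‖ := by
  simp [gradient]

theorem gradient_comp_of_differentiable {Ψ : ℝ → ℝ} {φ : EuclideanSpace ℝ (Fin n) → ℝ}
    (hΨ : Differentiable ℝ Ψ) (hφ : Differentiable ℝ φ) (x : EuclideanSpace ℝ (Fin n)) :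
    gradient (fun y => Ψ (φ y)) x = deriv Ψ (φ x) • gradient φ x := by
  have h := ((hΨ (φ x)).hasDerivAt.comp_hasFDerivAt x (hφ x).hasFDerivAt).fderiv
  have h' : fderiv ℝ (fun y => Ψ (φ y)) x = deriv Ψ (φ x) • fderiv ℝ φ x := h
  simp [gradient, h']

namespace IsTestFunction

variable {φ ψ : EuclideanSpace ℝ (Fin n) → ℝ}

theorem differentiable (h : IsTestFunction Ω φ) : Differentiable ℝ φ :=
  h.1.differentiable (by simp)

theorem continuous_gradient (h : IsTestFunction Ω φ) : Continuous (gradient φ) :=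
  (InnerProductSpace.toDual ℝ (EuclideanSpace ℝ (Fin n))).symm.continuous.comp
    (h.1.continuous_fderiv (by simp))

theorem support_gradient_subset (φ : EuclideanSpace ℝ (Fin n) → ℝ) :
    Function.support (gradient φ) ⊆ tsupport φ := by
  intro x hx
  apply support_fderiv_subset ℝ
  rw [Function.mem_support, ← norm_ne_zero_iff, norm_gradient_eq_norm_fderiv φ x] at hx
  exact norm_ne_zero_iff.1 hx

theorem hasCompactSupport_gradient (h : IsTestFunction Ω φ) : HasCompactSupport (gradient φ) :=
  h.2.1.mono' (support_gradient_subset φ)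

theorem memLp (h : IsTestFunction Ω φ) (p : ENNReal) :
    MemLp φ p (volume.restrict Ω) :=
  (h.1.continuous.memLp_of_hasCompactSupport h.2.1).restrict Ω

theorem memLp_gradient (h : IsTestFunction Ω φ) (p : ENNReal) :
    MemLp (gradient φ) p (volume.restrict Ω) :=
  (h.continuous_gradient.memLp_of_hasCompactSupport h.hasCompactSupport_gradient).restrict Ω

theorem comp {Ψ : ℝ → ℝ} (hΨ : ContDiff ℝ (⊤ : ℕ∞) Ψ) (h0 : Ψ 0 = 0) (h : IsTestFunction Ω φ) :
    IsTestFunction Ω (fun x => Ψ (φ x)) := by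
  refine ⟨hΨ.comp h.1, h.2.1.comp_left h0, (closure_mono ?_).trans h.2.2⟩
  intro x hx hφ
  exact hx (by simp [hφ, h0])

/-- Integration by parts for two test functions. -/
theorem integral_smul_gradient (hψ : IsTestFunction Ω ψ) (hφ : IsTestFunction Ω φ) :
    ∫ x in Ω, ψ x • gradient φ x = - ∫ x in Ω, φ x • gradient ψ x := by
  have aux : ∀ {ψ φ : EuclideanSpace ℝ (Fin n) → ℝ}, IsTestFunction Ω ψ → IsTestFunction Ω φ →
      Integrable (fun x => ψ x • gradient φ x) ∧
      ∫ x in Ω, ψ x • gradient φ x = ∫ x, ψ x • gradient φ x := by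
    intro ψ φ hψ hφ
    refine ⟨(hψ.1.continuous.smul hφ.continuous_gradient).integrable_of_hasCompactSupport
      (hψ.2.1.smul_right), setIntegral_eq_integral_of_forall_compl_eq_zero ?_⟩
    intro x hx
    rw [image_eq_zero_of_notMem_tsupport (fun h => hx (hψ.2.2 h)), zero_smul]
  rw [(aux hψ hφ).2, (aux hφ hψ).2]
  refine ext_inner_left ℝ fun v => ?_
  rw [inner_neg_right, ← integral_inner (aux hψ hφ).1, ← integral_inner (aux hφ hψ).1]
  have key : ∀ (φ : EuclideanSpace ℝ (Fin n) → ℝ) (x : EuclideanSpace ℝ (Fin n)),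
      inner ℝ v (gradient φ x) = fderiv ℝ φ x v := by
    intro φ x
    rw [real_inner_comm]
    simp [gradient]
  simp only [inner_smul_right, key]
  have hI : ∀ {ψ φ : EuclideanSpace ℝ (Fin n) → ℝ}, IsTestFunction Ω ψ → IsTestFunction Ω φ →
      Integrable (fun x => ψ x * fderiv ℝ φ x v) := by
    intro ψ φ hψ hφ
    have := (aux hψ hφ).1.const_inner (𝕜 := ℝ) v
    simpa only [inner_smul_right, key] using this
  rw [integral_mul_fderiv_eq_neg_fderiv_mul_of_integrable (by simpa [mul_comm] using hI hφ hψ)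
    (hI hψ hφ) ((hψ.1.continuous.mul hφ.1.continuous).integrable_of_hasCompactSupport
      (hψ.2.1.mul_right)) (fun x _ => hψ.differentiable x) (fun x _ => hφ.differentiable x)]
  simp [mul_comm]

end IsTestFunction

end Sobolev

/-! ### Passage to the limit in `L²` -/

theorem tendsto_integral_smul_of_tendsto_eLpNorm {X F : Type*} [MeasurableSpace X] {ν : Measure X}
    [NormedAddCommGroup F] [NormedSpace ℝ F]
    {g : ℕ → X → ℝ} {g₀ : X → ℝ} {h : X → F} (hg : ∀ k, MemLp (g k) 2 ν) (hg₀ : MemLp g₀ 2 ν)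
    (hh : MemLp h 2 ν) (hlim : Tendsto (fun k => eLpNorm (fun x => g k x - g₀ x) 2 ν) atTop (𝓝 0)) :
    Tendsto (fun k => ∫ x, g k x • h x ∂ν) atTop (𝓝 (∫ x, g₀ x • h x ∂ν)) := by
  refine tendsto_integral_of_L1' _ ((hg₀.1.smul hh.1))
    (Eventually.of_forall fun k => memLp_one_iff_integrable.1 (hh.smul (hg k))) ?_
  have hb : Tendsto (fun k => eLpNorm (fun x => g k x - g₀ x) 2 ν * eLpNorm h 2 ν) atTop (𝓝 0) := by
    simpa using ENNReal.Tendsto.mul_const hlim (Or.inr hh.2.ne)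
  refine tendsto_of_tendsto_of_tendsto_of_le_of_le tendsto_const_nhds hb (fun _ => zero_le)
    fun k => ?_
  have := eLpNorm_smul_le_mul_eLpNorm (p := 2) (q := 2) (r := 1) hh.1 ((hg k).1.sub hg₀.1)
  refine le_trans (le_of_eq ?_) this
  congr 1
  ext x
  simp [sub_smul]

theorem tendsto_integral_smul_of_tendsto_eLpNorm' {X F : Type*} [MeasurableSpace X] {ν : Measure X}
    [NormedAddCommGroup F] [NormedSpace ℝ F]
    {g : ℕ → X → F} {g₀ : X → F} {h : X → ℝ} (hg : ∀ k, MemLp (g k) 2 ν) (hg₀ : MemLp g₀ 2 ν)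
    (hh : MemLp h 2 ν) (hlim : Tendsto (fun k => eLpNorm (fun x => g k x - g₀ x) 2 ν) atTop (𝓝 0)) :
    Tendsto (fun k => ∫ x, h x • g k x ∂ν) atTop (𝓝 (∫ x, h x • g₀ x ∂ν)) := by
  refine tendsto_integral_of_L1' _ ((hh.1.smul hg₀.1))
    (Eventually.of_forall fun k => memLp_one_iff_integrable.1 ((hg k).smul hh)) ?_
  have hb : Tendsto (fun k => eLpNorm h 2 ν * eLpNorm (fun x => g k x - g₀ x) 2 ν) atTop (𝓝 0) := by
    simpa using ENNReal.Tendsto.const_mul hlim (Or.inr hh.2.ne)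
  refine tendsto_of_tendsto_of_tendsto_of_le_of_le tendsto_const_nhds hb (fun _ => zero_le)
    fun k => ?_
  have := eLpNorm_smul_le_mul_eLpNorm (p := 2) (q := 2) (r := 1) ((hg k).1.sub hg₀.1) hh.1
  refine le_trans (le_of_eq ?_) this
  congr 1
  ext x
  simp [smul_sub]

theorem exists_subseq_tendsto_ae_of_tendsto_eLpNorm {X F : Type*} [MeasurableSpace X]
    {ν : Measure X} [NormedAddCommGroup F] {g : ℕ → X → F} {g₀ : X → F}
    (hg : ∀ k, AEStronglyMeasurable (g k) ν) (hg₀ : AEStronglyMeasurable g₀ ν)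
    (hlim : Tendsto (fun k => eLpNorm (fun x => g k x - g₀ x) 2 ν) atTop (𝓝 0)) :
    ∃ ns : ℕ → ℕ, StrictMono ns ∧
      ∀ᵐ x ∂ν, Tendsto (fun k => g (ns k) x) atTop (𝓝 (g₀ x)) :=
  (tendstoInMeasure_of_tendsto_eLpNorm (p := 2) (by simp) hg hg₀ hlim).exists_seq_tendsto_ae

section Sobolev

variable {n : ℕ} {Ω : Set (EuclideanSpace ℝ (Fin n))}

/-- The weak gradient identity comes for free: it holds for each approximating test function by
integration by parts, and both sides pass to the `L²` limit. -/
theorem HasW012Gradient.of_tendsto {v : EuclideanSpace ℝ (Fin n) → ℝ}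
    {Dv : EuclideanSpace ℝ (Fin n) → EuclideanSpace ℝ (Fin n)}
    (hv : MemLp v 2 (volume.restrict Ω)) (hDv : MemLp Dv 2 (volume.restrict Ω))
    {ψ : ℕ → EuclideanSpace ℝ (Fin n) → ℝ} (hψ : ∀ k, IsTestFunction Ω (ψ k))
    (h₁ : Tendsto (fun k => eLpNorm (fun x => ψ k x - v x) 2 (volume.restrict Ω)) atTop (𝓝 0))
    (h₂ : Tendsto (fun k => eLpNorm (fun x => gradient (ψ k) x - Dv x) 2 (volume.restrict Ω))
      atTop (𝓝 0)) : HasW012Gradient Ω v Dv := by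
  refine ⟨⟨hv, hDv, fun φ hφ => ?_⟩, ψ, hψ, h₁, h₂⟩
  have l₁ := tendsto_integral_smul_of_tendsto_eLpNorm (fun k => (hψ k).memLp 2) hv
    (hφ.memLp_gradient 2) h₁
  have l₂ := tendsto_integral_smul_of_tendsto_eLpNorm' (fun k => (hψ k).memLp_gradient 2) hDv
    (hφ.memLp 2) h₂
  simp only [(hψ _).integral_smul_gradient hφ] at l₁
  exact tendsto_nhds_unique l₁ l₂.neg

end Sobolev

/-- `(f_k - f) h → 0` in `L²` if `f_k → f` almost everywhere, `f_k - f` is bounded and `h ∈ L²`. -/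
theorem tendsto_eLpNorm_smul_of_tendsto_ae {X F : Type*} [MeasurableSpace X] {ν : Measure X}
    [NormedAddCommGroup F] [NormedSpace ℝ F] {g : ℕ → X → ℝ} {h : X → F} {K : ℝ}
    (hg : ∀ k, AEStronglyMeasurable (g k) ν) (hK : ∀ k x, |g k x| ≤ K) (hh : MemLp h 2 ν)
    (hlim : ∀ᵐ x ∂ν, Tendsto (fun k => g k x) atTop (𝓝 0)) :
    Tendsto (fun k => eLpNorm (fun x => g k x • h x) 2 ν) atTop (𝓝 0) := by
  have h2 : (2 : ENNReal) ≠ 0 := by simp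
  have h2' : (2 : ENNReal) ≠ ⊤ := by simp
  have hfin : ∫⁻ x, ‖K • h x‖ₑ ^ (2 : ENNReal).toReal ∂ν ≠ ⊤ :=
    (lintegral_rpow_enorm_lt_top_of_eLpNorm_lt_top h2 h2' (hh.const_smul K).2).ne
  have key : Tendsto (fun k => ∫⁻ x, ‖g k x • h x‖ₑ ^ (2 : ENNReal).toReal ∂ν) atTop
      (𝓝 (∫⁻ _, 0 ∂ν)) := by
    refine tendsto_lintegral_of_dominated_convergence'
      (fun x => ‖K • h x‖ₑ ^ (2 : ENNReal).toReal)
      (fun k => (((hg k).smul hh.1).enorm.pow_const _)) (fun k => ?_) hfin ?_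
    · refine Eventually.of_forall fun x => ?_
      refine ENNReal.rpow_le_rpow ?_ (by simp)
      rw [enorm_le_iff_norm_le, norm_smul, norm_smul]
      gcongr
      exact (hK k x).trans (le_abs_self K)
    · filter_upwards [hlim] with x hx
      have : Tendsto (fun k => g k x • h x) atTop (𝓝 0) := by simpa using hx.smul_const (h x)
      have := (ENNReal.continuous_rpow_const (y := (2 : ENNReal).toReal)).continuousAt.tendsto.comp
        ((continuous_enorm.tendsto _).comp this)
      simpa [Function.comp_def] using this
  simp only [eLpNorm_eq_lintegral_rpow_enorm_toReal h2 h2']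
  have := (ENNReal.continuous_rpow_const
    (y := 1 / (2 : ENNReal).toReal)).continuousAt.tendsto.comp key
  simpa [Function.comp_def] using this

/-! ### Chain rule and Sobolev inequality in `W_0^{1,2}` -/

section Sobolev

variable {n : ℕ} {Ω : Set (EuclideanSpace ℝ (Fin n))}

/-- The chain rule in `W_0^{1,2}`. -/
theorem HasW012Gradient.comp {u : EuclideanSpace ℝ (Fin n) → ℝ}
    {Du : EuclideanSpace ℝ (Fin n) → EuclideanSpace ℝ (Fin n)} (hu : HasW012Gradient Ω u Du)
    {Ψ : ℝ → ℝ} (hΨ : ContDiff ℝ (⊤ : ℕ∞) Ψ) (h0 : Ψ 0 = 0) {K : ℝ}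
    (hK : ∀ s, |deriv Ψ s| ≤ K) :
    HasW012Gradient Ω (fun x => Ψ (u x)) (fun x => deriv Ψ (u x) • Du x) := by
  obtain ⟨⟨huL, hDuL, -⟩, φ, hφ, h₁, h₂⟩ := hu
  obtain ⟨ns, hns, hae⟩ := exists_subseq_tendsto_ae_of_tendsto_eLpNorm
    (fun k => ((hφ k).memLp 2).1) huL.1 h₁
  have hK0 : 0 ≤ K := (abs_nonneg _).trans (hK 0)
  have hdiff : Differentiable ℝ Ψ := hΨ.differentiable (by simp)
  have hcont : Continuous (deriv Ψ) := hΨ.continuous_deriv (by simp)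
  have hlip : ∀ s t, ‖Ψ s - Ψ t‖ ≤ K * ‖s - t‖ := fun s t =>
    Convex.norm_image_sub_le_of_norm_deriv_le (fun x _ => hdiff x) (fun x _ => hK x) convex_univ
      (Set.mem_univ t) (Set.mem_univ s)
  have hm : AEStronglyMeasurable (fun x => deriv Ψ (u x)) (volume.restrict Ω) :=
    hcont.comp_aestronglyMeasurable huL.1
  have hmk : ∀ k, AEStronglyMeasurable (fun x => deriv Ψ (φ k x)) (volume.restrict Ω) := fun k =>
    hcont.comp_aestronglyMeasurable ((hφ k).memLp 2).1
  refine HasW012Gradient.of_tendsto (ψ := fun k x => Ψ (φ (ns k) x)) ?_ ?_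
    (fun k => (hφ (ns k)).comp hΨ h0) ?_ ?_
  · refine huL.of_le_mul (c := K) (hΨ.continuous.comp_aestronglyMeasurable huL.1)
      (Eventually.of_forall fun x => ?_)
    simpa [h0] using hlip (u x) 0
  · refine hDuL.of_le_mul (c := K) (hm.smul hDuL.1) (Eventually.of_forall fun x => ?_)
    rw [norm_smul]
    gcongr
    exact hK _
  · have hb : Tendsto (fun k => ENNReal.ofReal K *
        eLpNorm (fun x => φ (ns k) x - u x) 2 (volume.restrict Ω)) atTop (𝓝 0) := by
      simpa using ENNReal.Tendsto.const_mul (h₁.comp hns.tendsto_atTop)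
        (Or.inr (ENNReal.ofReal_ne_top (r := K)))
    refine tendsto_of_tendsto_of_tendsto_of_le_of_le tendsto_const_nhds hb (fun _ => zero_le)
      fun k => ?_
    exact eLpNorm_le_mul_eLpNorm_of_ae_le_mul
      (Eventually.of_forall fun x => hlip (φ (ns k) x) (u x)) 2
  · have hb : Tendsto (fun k => ENNReal.ofReal K *
        eLpNorm (fun x => gradient (φ (ns k)) x - Du x) 2 (volume.restrict Ω)) atTop (𝓝 0) := by
      simpa using ENNReal.Tendsto.const_mul (h₂.comp hns.tendsto_atTop)
        (Or.inr (ENNReal.ofReal_ne_top (r := K)))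
    -- The gradient error is `Ψ'(φ)(∇φ - Du) + (Ψ'(φ) - Ψ'(u)) Du`. The second factor converges only
    -- pointwise and boundedly, hence the a.e. convergent subsequence and dominated convergence
    -- against `|Du|²`.
    have hc : Tendsto (fun k => eLpNorm
        (fun x => (deriv Ψ (φ (ns k) x) - deriv Ψ (u x)) • Du x) 2 (volume.restrict Ω))
        atTop (𝓝 0) := by
      refine tendsto_eLpNorm_smul_of_tendsto_ae (K := K + K) (fun k => (hmk _).sub hm)
        (fun k x => (abs_sub _ _).trans (add_le_add (hK _) (hK _))) hDuL ?_
      filter_upwards [hae] with x hx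
      simpa using ((hcont.tendsto _).comp hx).sub_const (deriv Ψ (u x))
    have hbc := hb.add hc
    rw [add_zero] at hbc
    refine tendsto_of_tendsto_of_tendsto_of_le_of_le tendsto_const_nhds hbc (fun _ => zero_le)
      fun k => ?_
    have hsplit : (fun x => gradient (fun y => Ψ (φ (ns k) y)) x - deriv Ψ (u x) • Du x) =
        (fun x => deriv Ψ (φ (ns k) x) • (gradient (φ (ns k)) x - Du x)) +
          fun x => (deriv Ψ (φ (ns k) x) - deriv Ψ (u x)) • Du x := by
      ext1 x
      rw [gradient_comp_of_differentiable hdiff (hφ _).differentiable]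
      simp only [Pi.add_apply, smul_sub, sub_smul]
      abel
    simp only [hsplit]
    refine (eLpNorm_add_le ((hmk _).smul (((hφ _).memLp_gradient 2).1.sub hDuL.1))
      (((hmk _).sub hm).smul hDuL.1) (by norm_num)).trans (add_le_add ?_ le_rfl)
    refine eLpNorm_le_mul_eLpNorm_of_ae_le_mul (Eventually.of_forall fun x => ?_) 2
    change ‖deriv Ψ (φ (ns k) x) • (gradient (φ (ns k)) x - Du x)‖ ≤ _
    rw [norm_smul]
    gcongr
    exact hK _

/-- The Sobolev inequality in `W_0^{1,2}`, with a constant independent of the domain. -/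
theorem exists_sobolev_const (n : ℕ) (hn : 2 < n) :
    ∃ S : NNReal, ∀ (Ω : Set (EuclideanSpace ℝ (Fin n))) (v : EuclideanSpace ℝ (Fin n) → ℝ)
      (Dv : EuclideanSpace ℝ (Fin n) → EuclideanSpace ℝ (Fin n)), HasW012Gradient Ω v Dv →
      eLpNorm v (ENNReal.ofReal (2 * n / (n - 2))) (volume.restrict Ω) ≤
        S * eLpNorm Dv 2 (volume.restrict Ω) := by
  have hn' : (2 : ℝ) < n := by exact_mod_cast hn
  refine ⟨SNormLESNormFDerivOfEqConst ℝ
    (volume : Measure (EuclideanSpace ℝ (Fin n))) (2 : NNReal), fun Ω v Dv hv => ?_⟩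
  obtain ⟨⟨hvL, hDvL, -⟩, φ, hφ, h₁, h₂⟩ := hv
  obtain ⟨ns, hns, hae⟩ := exists_subseq_tendsto_ae_of_tendsto_eLpNorm
    (fun k => ((hφ k).memLp 2).1) hvL.1 h₁
  set S := SNormLESNormFDerivOfEqConst ℝ
    (volume : Measure (EuclideanSpace ℝ (Fin n))) (2 : NNReal)
  have hb : Tendsto (fun k => (S : ENNReal) * (eLpNorm Dv 2 (volume.restrict Ω) +
      eLpNorm (fun x => gradient (φ (ns k)) x - Dv x) 2 (volume.restrict Ω))) atTop
      (𝓝 (S * eLpNorm Dv 2 (volume.restrict Ω))) := by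
    refine ENNReal.Tendsto.const_mul ?_ (Or.inr ENNReal.coe_ne_top)
    simpa using (tendsto_const_nhds (x := eLpNorm Dv 2 (volume.restrict Ω))).add
      (h₂.comp hns.tendsto_atTop)
  -- Fatou's lemma along the a.e. convergent subsequence, so no convergence in the Sobolev exponent
  -- is needed.
  refine (Lp.eLpNorm_lim_le_liminf_eLpNorm (fun k => ((hφ (ns k)).memLp 2).1) v hae).trans ?_
  rw [← hb.liminf_eq]
  refine liminf_le_liminf (Eventually.of_forall fun k => ?_)
  have hs := eLpNorm_le_eLpNorm_fderiv_of_eq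
    (volume : Measure (EuclideanSpace ℝ (Fin n))) ((hφ (ns k)).1.of_le (by simp))
    (hφ (ns k)).2.1 (p := 2) (p' := (2 * n / (n - 2) : ℝ).toNNReal) (by norm_num)
    (by simp; omega) (by
      rw [Real.coe_toNNReal _ (by apply div_nonneg <;> linarith)]
      simp only [finrank_euclideanSpace, Fintype.card_fin]
      have : (n : ℝ) - 2 ≠ 0 := by linarith
      field_simp
      push_cast
      ring)
  calc eLpNorm (φ (ns k)) (ENNReal.ofReal (2 * n / (n - 2))) (volume.restrict Ω)
      ≤ eLpNorm (φ (ns k)) (ENNReal.ofReal (2 * n / (n - 2))) volume :=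
        eLpNorm_mono_measure _ Measure.restrict_le_self
    _ ≤ S * eLpNorm (fderiv ℝ (φ (ns k))) 2 volume := hs
    _ = S * eLpNorm (gradient (φ (ns k))) 2 (volume.restrict Ω) := by
        -- Test functions are supported in `Ω`, so the whole-space inequality applies and `S` does
        -- not see the domain.
        rw [eLpNorm_restrict_eq_of_support_subset
          ((IsTestFunction.support_gradient_subset _).trans (hφ (ns k)).2.2)]
        congr 1
        exact eLpNorm_congr_norm_ae
          (Eventually.of_forall fun x => (norm_gradient_eq_norm_fderiv _ x).symm)
    _ ≤ _ := by
        gcongr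
        have := eLpNorm_add_le hDvL.1 (((hφ (ns k)).memLp_gradient 2).1.sub hDvL.1)
          (show (1 : ENNReal) ≤ 2 by norm_num)
        refine le_trans (le_of_eq ?_) this
        congr 1
        ext1 x
        simp

end Sobolev

/-! ### Integrals of Marcinkiewicz functions over small sets -/

theorem setLIntegral_enorm_le_of_weak_bound {X : Type*} [MeasurableSpace X] {ν : Measure X}
    {f : X → ℝ} (hf : AEMeasurable f ν) {m γ : ℝ} (hm : 1 < m) (hγ : 0 < γ)
    (hw : ∀ t : ℝ, 0 < t → ν {x | t < |f x|} ≤ ENNReal.ofReal (γ / t ^ m))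
    {A : Set X} (hA : ν A ≠ ⊤) :
    ∫⁻ x in A, ‖f x‖ₑ ∂ν ≤
      ENNReal.ofReal (m / (m - 1) * γ ^ (1 / m) * ν.real A ^ (1 - 1 / m)) := by
  rcases eq_or_ne (ν A) 0 with h0 | h0
  · rw [setLIntegral_measure_zero _ _ h0]
    exact zero_le
  have hV : 0 < ν.real A := ENNReal.toReal_pos h0 hA
  have hVA : ν A = ENNReal.ofReal (ν.real A) := (ENNReal.ofReal_toReal hA).symm
  set V := ν.real A
  -- The level where the two available bounds for the distribution function on `A` cross: the
  -- trivial bound `V` is used below it, `γ / t ^ m` above it.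
  set t₀ := (γ / V) ^ (1 / m) with ht₀
  have hm0 : 0 < m := by linarith
  have ht₀pos : 0 < t₀ := Real.rpow_pos_of_pos (div_pos hγ hV) _
  have ht₀m : t₀ ^ m = γ / V := by
    rw [ht₀, ← Real.rpow_mul (div_pos hγ hV).le, one_div_mul_cancel hm0.ne', Real.rpow_one]
  have e₁ : V * t₀ = γ ^ (1 / m) * V ^ (1 - 1 / m) := by
    rw [ht₀, Real.div_rpow hγ.le hV.le, Real.rpow_sub hV, Real.rpow_one]
    ring
  have e₂ : γ * (-t₀ ^ (-m + 1) / (-m + 1)) = V * t₀ / (m - 1) := by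
    rw [Real.rpow_add ht₀pos, Real.rpow_neg ht₀pos.le, ht₀m, Real.rpow_one]
    have h1 : m - 1 ≠ 0 := by linarith
    have h2 : -m + 1 = -(m - 1) := by ring
    rw [h2]
    field_simp
  have hint : ∫⁻ t in Set.Ioi t₀, ENNReal.ofReal (γ / t ^ m) = ENNReal.ofReal (V * t₀ / (m - 1)) := by
    have hI : IntegrableOn (fun t : ℝ => γ * t ^ (-m)) (Set.Ioi t₀) :=
      (integrableOn_Ioi_rpow_of_lt (by linarith) ht₀pos).const_mul γ
    rw [← e₂, ← integral_Ioi_rpow_of_lt (by linarith) ht₀pos, ← integral_const_mul,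
      ofReal_integral_eq_lintegral_ofReal hI]
    · refine setLIntegral_congr_fun measurableSet_Ioi fun t ht => ?_
      simp only [Set.mem_Ioi] at ht
      rw [Real.rpow_neg (ht₀pos.trans ht).le, div_eq_mul_inv]
    · filter_upwards [ae_restrict_mem measurableSet_Ioi] with t ht
      exact mul_nonneg hγ.le (Real.rpow_nonneg (ht₀pos.trans ht).le _)
  calc ∫⁻ x in A, ‖f x‖ₑ ∂ν = ∫⁻ x in A, ENNReal.ofReal |f x| ∂ν := by
        simp only [← ofReal_norm, Real.norm_eq_abs]
    _ = ∫⁻ t in Set.Ioi 0, ν.restrict A {x | t < |f x|} :=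
        lintegral_eq_lintegral_meas_lt _ (Eventually.of_forall fun x => abs_nonneg _)
          (hf.restrict.norm)
    _ = ∫⁻ t in Set.Ioc 0 t₀ ∪ Set.Ioi t₀, ν.restrict A {x | t < |f x|} := by
        rw [Set.Ioc_union_Ioi_eq_Ioi ht₀pos.le]
    _ ≤ (∫⁻ t in Set.Ioc 0 t₀, ν.restrict A {x | t < |f x|}) +
        ∫⁻ t in Set.Ioi t₀, ν.restrict A {x | t < |f x|} := lintegral_union_le _ _ _
    _ ≤ (∫⁻ _ in Set.Ioc 0 t₀, ENNReal.ofReal V) +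
        ∫⁻ t in Set.Ioi t₀, ENNReal.ofReal (γ / t ^ m) := by
        refine add_le_add (lintegral_mono fun t => ?_)
          (setLIntegral_mono' measurableSet_Ioi fun t ht => ?_)
        · exact (measure_mono (Set.subset_univ _)).trans (by rw [Measure.restrict_apply_univ, hVA])
        · exact (Measure.restrict_le_self _).trans (hw t (ht₀pos.trans ht))
    _ = ENNReal.ofReal (V * t₀) + ENNReal.ofReal (V * t₀ / (m - 1)) := by
        rw [hint, setLIntegral_const, Real.volume_Ioc, sub_zero, ENNReal.ofReal_mul hV.le]
    _ = ENNReal.ofReal (m / (m - 1) * γ ^ (1 / m) * V ^ (1 - 1 / m)) := by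
        have h1 : 0 < m - 1 := by linarith
        rw [← ENNReal.ofReal_add (by positivity) (by positivity), mul_assoc, ← e₁]
        congr 1
        field_simp
        ring

/-! ### Stampacchia's iteration lemmas -/

section Decay

variable {φ : ℝ → ℝ} {D a b : ℝ}

/-- `φ` is nonnegative, nonincreasing on `[0, ∞)` and `φ(k + δ) ≤ D δ^{-a} φ(k)^b`. -/
structure LevelDecay (D a b : ℝ) (φ : ℝ → ℝ) : Prop where
  nonneg : ∀ t, 0 ≤ φ t
  antitone : Antitone φ
  le_rpow : ∀ k δ, 0 ≤ k → 0 < δ → φ (k + δ) ≤ D * δ ^ (-a) * φ k ^ b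

/-- Stampacchia's lemma, vanishing case. -/
theorem exists_levelDecay_eq_zero (hD : 0 < D) (ha : 0 < a) (hb : 1 < b) (V : ℝ) :
    ∃ d : ℝ, 0 < d ∧ ∀ φ, LevelDecay D a b φ → φ 0 ≤ V → φ d = 0 := by
  -- A positive bound for `φ 0` chosen before `φ`, so that `d` is uniform in `φ`.
  set W := |V| + 1
  have hW : 0 < W := by positivity
  have hb1 : 0 < b - 1 := by linarith
  -- Along the levels `d (1 - 2^{-j})` the steps halve, which costs a factor `2^{aj}`. Since
  -- `r^{b-1} = 2^{-a}`, the superlinear power `b` of the geometric bound `W r^j` gains exactly that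
  -- factor back.
  set r : ℝ := 2 ^ (-(a / (b - 1)))
  have hr : 0 < r := by positivity
  have hr1 : r < 1 := Real.rpow_lt_one_of_one_lt_of_neg (by norm_num) (by
    rw [neg_lt_zero]; positivity)
  have hrb : r ^ (b - 1) = 2 ^ (-a) := by
    rw [← Real.rpow_mul (by norm_num)]
    congr 1
    field_simp
  -- With `d^a = M` the inductive bound reproduces itself with equality.
  set M := D * 2 ^ a * W ^ (b - 1) / r
  have hM : 0 < M := by positivity
  set d := M ^ (1 / a)
  have hd : 0 < d := Real.rpow_pos_of_pos hM _
  have hda : d ^ (-a) = M⁻¹ := by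
    rw [Real.rpow_neg hd.le, ← Real.rpow_mul hM.le, one_div_mul_cancel ha.ne', Real.rpow_one]
  refine ⟨d, hd, fun φ h hφ0 => ?_⟩
  have key : ∀ j : ℕ, φ (d * (1 - (1 / 2) ^ j)) ≤ W * r ^ j := by
    intro j
    induction j with
    | zero => simpa using hφ0.trans ((le_abs_self V).trans (by simp [W]))
    | succ j ih =>
      have hp : (0 : ℝ) < (1 / 2) ^ (j + 1) := by positivity
      have hk : 0 ≤ d * (1 - (1 / 2 : ℝ) ^ j) :=
        mul_nonneg hd.le (sub_nonneg.2 (pow_le_one₀ (by norm_num) (by norm_num)))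
      have h1 := h.le_rpow _ (d * (1 / 2) ^ (j + 1)) hk (mul_pos hd hp)
      have e1 : d * (1 - (1 / 2 : ℝ) ^ j) + d * (1 / 2) ^ (j + 1) =
          d * (1 - (1 / 2) ^ (j + 1)) := by ring
      rw [e1] at h1
      refine h1.trans ?_
      have h2 : φ (d * (1 - (1 / 2) ^ j)) ^ b ≤ (W * r ^ j) ^ b :=
        Real.rpow_le_rpow (h.nonneg _) ih (by linarith)
      have e2 : (d * (1 / 2 : ℝ) ^ (j + 1)) ^ (-a) = M⁻¹ * (2 ^ a * (2 ^ a) ^ j) := by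
        rw [Real.mul_rpow hd.le hp.le, hda, one_div, inv_pow, Real.inv_rpow (by positivity),
          Real.rpow_neg (by positivity), inv_inv, ← Real.rpow_natCast, ← Real.rpow_mul (by norm_num),
          ← Real.rpow_natCast (2 ^ a), ← Real.rpow_mul (by norm_num), ← Real.rpow_add (by norm_num)]
        push_cast
        congr 2
        ring
      have e3 : (W * r ^ j) ^ b = W * W ^ (b - 1) * (r ^ j * (2 ^ (-a)) ^ j) := by
        have hsplit : ∀ {y : ℝ}, 0 < y → y ^ b = y * y ^ (b - 1) := fun {y} hy => by
          rw [Real.rpow_sub hy, Real.rpow_one]; field_simp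
        rw [Real.mul_rpow hW.le (by positivity), hsplit hW, hsplit (y := r ^ j) (by positivity)]
        congr 2
        rw [← hrb, ← Real.rpow_natCast, ← Real.rpow_natCast, ← Real.rpow_mul hr.le,
          ← Real.rpow_mul hr.le, mul_comm]
      calc D * (d * (1 / 2) ^ (j + 1)) ^ (-a) * φ (d * (1 - (1 / 2) ^ j)) ^ b
          ≤ D * (d * (1 / 2) ^ (j + 1)) ^ (-a) * (W * r ^ j) ^ b := by gcongr
        _ = W * r ^ (j + 1) := by
          rw [e2, e3, Real.rpow_neg (by norm_num), inv_pow]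
          simp only [M]
          have : (2 : ℝ) ^ a ≠ 0 := by positivity
          have : W ^ (b - 1) ≠ 0 := by positivity
          field_simp
          ring
  have hle : ∀ j : ℕ, φ d ≤ W * r ^ j := fun j => by
    refine (h.antitone ?_).trans (key j)
    have : (0 : ℝ) < (1 / 2) ^ j := by positivity
    nlinarith
  have hlim : Tendsto (fun j : ℕ => W * r ^ j) atTop (𝓝 0) := by
    simpa using (tendsto_pow_atTop_nhds_zero_of_lt_one hr.le hr1).const_mul W
  exact le_antisymm (ge_of_tendsto' hlim hle) (h.nonneg d)

/-- Stampacchia's lemma, exponential case. -/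
theorem LevelDecay.exists_le_exp (h : LevelDecay D a 1 φ) (hD : 0 < D) (ha : 0 < a) :
    ∃ C ζ : ℝ, 0 < C ∧ 0 < ζ ∧ ∀ t, 0 ≤ t → φ t ≤ C * Real.exp (-(ζ * t)) := by
  -- The step length for which `D τ^{-a} = e⁻¹`: each step divides `φ` by at least `e`.
  set τ := (D * Real.exp 1) ^ (1 / a)
  have hDe : 0 < D * Real.exp 1 := by positivity
  have hτ : 0 < τ := Real.rpow_pos_of_pos hDe _
  have hτa : D * τ ^ (-a) = Real.exp (-1) := by
    rw [Real.rpow_neg hτ.le, ← Real.rpow_mul hDe.le, one_div_mul_cancel ha.ne', Real.rpow_one,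
      Real.exp_neg]
    field_simp
  have key : ∀ j : ℕ, φ (j * τ) ≤ φ 0 * Real.exp (-j) := by
    intro j
    induction j with
    | zero => simp
    | succ j ih =>
      have h1 := h.le_rpow (j * τ) τ (by positivity) hτ
      rw [hτa, Real.rpow_one] at h1
      have e1 : ((j + 1 : ℕ) : ℝ) * τ = j * τ + τ := by push_cast; ring
      rw [e1]
      refine h1.trans ((mul_le_mul_of_nonneg_left ih (Real.exp_pos _).le).trans (le_of_eq ?_))
      rw [mul_left_comm, ← Real.exp_add]
      push_cast
      congr 2
      ring
  -- The factor `e` pays for rounding `t` down to a multiple of `τ`; the `+ 1` keeps the constant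
  -- positive.
  refine ⟨(φ 0 + 1) * Real.exp 1, 1 / τ, ?_, by positivity, fun t ht => ?_⟩
  · have := h.nonneg 0
    positivity
  have hfl : (⌊t / τ⌋₊ : ℝ) * τ ≤ t := by
    have := Nat.floor_le (div_nonneg ht hτ.le)
    calc (⌊t / τ⌋₊ : ℝ) * τ ≤ t / τ * τ := by gcongr
      _ = t := by field_simp
  have hfl' := Nat.lt_floor_add_one (t / τ)
  calc φ t ≤ φ (⌊t / τ⌋₊ * τ) := h.antitone hfl
    _ ≤ φ 0 * Real.exp (-⌊t / τ⌋₊) := key _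
    _ ≤ (φ 0 + 1) * Real.exp (1 + -(1 / τ * t)) := by
        have := h.nonneg 0
        gcongr
        · linarith
        · rw [one_div_mul_eq_div]; linarith
    _ = _ := by rw [Real.exp_add]; ring

/-- Stampacchia's lemma, power case. -/
theorem LevelDecay.exists_le_rpow (h : LevelDecay D a b φ) (hD : 0 < D) (ha : 0 < a) (hb0 : 0 < b)
    (hb : b < 1) :
    ∃ C : ℝ, 0 < C ∧ ∀ t, 0 < t → φ t ≤ C * t ^ (-(a / (1 - b))) := by
  have hb1 : 0 < 1 - b := by linarith
  -- The exponent with `a = q - q b`, for which the inequality at `k = δ = t/2` becomes the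
  -- scale-free `t^q φ(t) ≤ E ((t/2)^q φ(t/2))^b`.
  set q := a / (1 - b) with hq
  have hq0 : 0 < q := by positivity
  have hqb : a = q - q * b := by rw [hq]; field_simp
  set E := D * 2 ^ (a + q * b)
  have hE : 0 < E := by positivity
  -- The first term covers `t ≤ 1`. The second makes `E M^b ≤ M`, so the bound `M` survives each
  -- doubling of the range of `t`.
  set M := φ 0 + E ^ (1 / (1 - b))
  have hφ0 := h.nonneg 0
  have hM : 0 < M := by positivity
  have hME : E * M ^ b ≤ M := by
    have h1 : E ≤ M ^ (1 - b) := by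
      calc E = (E ^ (1 / (1 - b))) ^ (1 - b) := by
            rw [← Real.rpow_mul hE.le, one_div_mul_cancel hb1.ne', Real.rpow_one]
        _ ≤ M ^ (1 - b) := by
            gcongr
            simpa [M] using hφ0
    calc E * M ^ b ≤ M ^ (1 - b) * M ^ b := by gcongr
      _ = M := by rw [← Real.rpow_add hM]; simp
  have key : ∀ (j : ℕ) (t : ℝ), 0 < t → t ≤ 2 ^ j → t ^ q * φ t ≤ M := by
    intro j
    induction j with
    | zero =>
      intro t ht ht1
      have h1 : t ^ q ≤ 1 := Real.rpow_le_one ht.le (by simpa using ht1) hq0.le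
      calc t ^ q * φ t ≤ 1 * φ 0 := mul_le_mul h1 (h.antitone ht.le) (h.nonneg _) zero_le_one
        _ ≤ M := by simp only [M, one_mul]; linarith [Real.rpow_pos_of_pos hE (1 / (1 - b))]
    | succ j ih =>
      intro t ht ht1
      have ht2 : 0 < t / 2 := by positivity
      have h1 := h.le_rpow (t / 2) (t / 2) ht2.le ht2
      rw [add_halves] at h1
      have h2 := ih (t / 2) ht2 (by rw [pow_succ] at ht1; linarith)
      have h3 : ((t / 2) ^ q * φ (t / 2)) ^ b ≤ M ^ b :=
        Real.rpow_le_rpow (mul_nonneg (by positivity) (h.nonneg _)) h2 hb0.le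
      have e : t ^ q * (D * (t / 2) ^ (-a) * φ (t / 2) ^ b) =
          E * ((t / 2) ^ q * φ (t / 2)) ^ b := by
        rw [Real.mul_rpow (by positivity) (h.nonneg _), ← Real.rpow_mul ht2.le]
        have e1 : t ^ q * (t / 2) ^ (-a) = 2 ^ (a + q * b) * (t / 2) ^ (q * b) := by
          have : t = 2 * (t / 2) := by ring
          nth_rw 1 [this]
          rw [Real.mul_rpow (by norm_num) ht2.le, mul_assoc, ← Real.rpow_add ht2]
          congr 2 <;> linarith
        calc _ = D * (t ^ q * (t / 2) ^ (-a)) * φ (t / 2) ^ b := by ring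
          _ = _ := by rw [e1]; ring
      calc t ^ q * φ t ≤ t ^ q * (D * (t / 2) ^ (-a) * φ (t / 2) ^ b) := by gcongr
        _ ≤ E * M ^ b := by rw [e]; gcongr
        _ ≤ M := hME
  refine ⟨M, hM, fun t ht => ?_⟩
  obtain ⟨j, hj⟩ := pow_unbounded_of_one_lt t (one_lt_two)
  have h1 := key j t ht hj.le
  rw [Real.rpow_neg ht.le, ← div_eq_mul_inv, le_div_iff₀ (by positivity)]
  linarith

end Decay

/-! ### Energy estimate and cutoffs -/

section WeakSolution

variable {n : ℕ} {Ω : Set (EuclideanSpace ℝ (Fin n))} {α β θ : ℝ}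
  {a : EuclideanSpace ℝ (Fin n) → ℝ → ℝ} {f u : EuclideanSpace ℝ (Fin n) → ℝ}

/-- Approximate `u` by simple functions: each composition involves only finitely many slices `a(·,
c)`, and continuity in the second variable carries measurability to the limit. -/
theorem IsCaratheodory.aemeasurable_comp (ha : IsCaratheodory Ω a)
    (hu : AEMeasurable u (volume.restrict Ω)) :
    AEMeasurable (fun x => a x (u x)) (volume.restrict Ω) := by
  have hsm := hu.measurable_mk.stronglyMeasurable
  refine aemeasurable_of_tendsto_metrizable_ae atTop (f := fun k x => a x (hsm.approx k x))
    (fun k => ?_) ?_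
  · refine ⟨fun x => (ha.aemeasurable (hsm.approx k x)).mk _ x,
      (hsm.approx k).measurable_bind (fun c x => (ha.aemeasurable c).mk _ x)
        fun c => (ha.aemeasurable c).measurable_mk, ?_⟩
    have hall := (ae_ball_iff (hsm.approx k).finite_range.countable).2
      fun c _ => (ha.aemeasurable c).ae_eq_mk
    filter_upwards [hall] with x hx
    exact hx _ ⟨x, rfl⟩
  · filter_upwards [ha.continuous, hu.ae_eq_mk] with x hx hux
    rw [hux]
    exact (hx.tendsto _).comp (hsm.tendsto_approx x)

theorem degeneracy_weight_pos (s θ : ℝ) :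
    0 < (1 + |s|) ^ θ * Real.log (Real.exp 1 + |s|) ^ θ := by
  have h1 : 0 < Real.log (Real.exp 1 + |s|) :=
    Real.log_pos (by linarith [Real.add_one_le_exp 1, abs_nonneg s])
  positivity

theorem one_le_log_exp_one_add_abs (s : ℝ) : 1 ≤ Real.log (Real.exp 1 + |s|) := by
  rw [Real.le_log_iff_exp_le (by positivity)]
  linarith [abs_nonneg s]

theorem one_le_degeneracy_weight (s : ℝ) {θ : ℝ} (hθ : 0 ≤ θ) :
    1 ≤ (1 + |s|) ^ θ * Real.log (Real.exp 1 + |s|) ^ θ :=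
  one_le_mul_of_one_le_of_one_le
    (Real.one_le_rpow (by linarith [abs_nonneg s]) hθ)
    (Real.one_le_rpow (one_le_log_exp_one_add_abs s) hθ)

/-- The energy estimate obtained by testing the equation with `Ψ(u)`. -/
theorem lintegral_enorm_grad_comp_sq_le (hα : 0 < α) (hθ : 0 ≤ θ)
    (ha : IsCaratheodory Ω a) (hab : DegenerateBounds Ω α β θ a)
    {Du : EuclideanSpace ℝ (Fin n) → EuclideanSpace ℝ (Fin n)} (hu : HasW012Gradient Ω u Du)
    (hsol : ∀ (v : EuclideanSpace ℝ (Fin n) → ℝ)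
      (Dv : EuclideanSpace ℝ (Fin n) → EuclideanSpace ℝ (Fin n)), HasW012Gradient Ω v Dv →
      ∫ x in Ω, a x (u x) * inner ℝ (Du x) (Dv x) = ∫ x in Ω, f x * v x)
    {Ψ : ℝ → ℝ} (hΨ : ContDiff ℝ (⊤ : ℕ∞) Ψ) (h0 : Ψ 0 = 0) {K : ℝ} (hK : 0 ≤ K)
    (hΨ0 : ∀ s, 0 ≤ deriv Ψ s)
    (hΨK : ∀ s, deriv Ψ s ≤ K / ((1 + |s|) ^ θ * Real.log (Real.exp 1 + |s|) ^ θ)) :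
    HasW012Gradient Ω (fun x => Ψ (u x)) (fun x => deriv Ψ (u x) • Du x) ∧
    ∫⁻ x in Ω, ‖deriv Ψ (u x) • Du x‖ₑ ^ (2 : ℝ) ≤
      ENNReal.ofReal (K / α) * ∫⁻ x in Ω, ‖f x‖ₑ * ‖Ψ (u x)‖ₑ := by
  have hΨb : ∀ s, |deriv Ψ s| ≤ K := fun s => by
    rw [abs_of_nonneg (hΨ0 s)]
    exact (hΨK s).trans (div_le_self hK (one_le_degeneracy_weight s hθ))
  have hv := hu.comp hΨ h0 hΨb
  refine ⟨hv, ?_⟩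
  have hDu := hu.hasW12Gradient.memLp_grad
  have huL := hu.hasW12Gradient.memLp
  have hinner : ∀ x, inner ℝ (Du x) (deriv Ψ (u x) • Du x) = deriv Ψ (u x) * ‖Du x‖ ^ 2 := by
    intro x
    rw [inner_smul_right, real_inner_self_eq_norm_sq]
  have hmeas : AEStronglyMeasurable
      (fun x => a x (u x) * inner ℝ (Du x) (deriv Ψ (u x) • Du x)) (volume.restrict Ω) :=
    (ha.aemeasurable_comp huL.1.aemeasurable).aestronglyMeasurable.mul
      (hDu.1.inner hv.hasW12Gradient.memLp_grad.1)
  have hint : Integrable (fun x => a x (u x) * inner ℝ (Du x) (deriv Ψ (u x) • Du x))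
      (volume.restrict Ω) := by
    -- The upper bound `β` serves only to make the energy density integrable; it does not enter the
    -- final constant.
    refine (hDu.integrable_norm_pow (by simp)).const_mul (β * K) |>.mono' hmeas ?_
    filter_upwards [hab] with x hx
    obtain ⟨h1, h2⟩ := hx (u x)
    have ha0 : 0 ≤ a x (u x) := (div_nonneg hα.le (degeneracy_weight_pos _ _).le).trans h1
    rw [hinner, Real.norm_of_nonneg (mul_nonneg ha0 (mul_nonneg (hΨ0 _) (by positivity))),
      mul_assoc]
    have := (le_abs_self _).trans (hΨb (u x))
    have hD := hΨ0 (u x)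
    have hβ : 0 ≤ β := ha0.trans h2
    gcongr
  have hpt : ∀ᵐ x ∂(volume.restrict Ω), ‖deriv Ψ (u x) • Du x‖ₑ ^ (2 : ℝ) ≤
      ENNReal.ofReal (K / α) *
        ENNReal.ofReal (a x (u x) * inner ℝ (Du x) (deriv Ψ (u x) • Du x)) := by
    filter_upwards [hab] with x hx
    obtain ⟨h1, -⟩ := hx (u x)
    rw [← ENNReal.ofReal_mul (by positivity), ← ofReal_norm,
      ENNReal.ofReal_rpow_of_nonneg (norm_nonneg _) (by norm_num), hinner]
    refine ENNReal.ofReal_le_ofReal ?_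
    rw [norm_smul, Real.norm_of_nonneg (hΨ0 _), Real.rpow_two, mul_pow]
    -- One of the two factors `Ψ'(u)` in `|Ψ'(u) Du|²` is traded for the coefficient, leaving the
    -- integrand of the weak formulation tested with `Ψ(u)`.
    have h3 : deriv Ψ (u x) ≤ K / α * a x (u x) := by
      refine (hΨK _).trans ?_
      calc _ = K / α * (α / ((1 + |u x|) ^ θ * Real.log (Real.exp 1 + |u x|) ^ θ)) := by
            field_simp
        _ ≤ _ := by gcongr
    calc deriv Ψ (u x) ^ 2 * ‖Du x‖ ^ 2 = deriv Ψ (u x) * (deriv Ψ (u x) * ‖Du x‖ ^ 2) := by ring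
      _ ≤ K / α * a x (u x) * (deriv Ψ (u x) * ‖Du x‖ ^ 2) :=
        mul_le_mul_of_nonneg_right h3 (mul_nonneg (hΨ0 _) (by positivity))
      _ = _ := by ring
  calc ∫⁻ x in Ω, ‖deriv Ψ (u x) • Du x‖ₑ ^ (2 : ℝ)
      ≤ ∫⁻ x in Ω, ENNReal.ofReal (K / α) *
        ENNReal.ofReal (a x (u x) * inner ℝ (Du x) (deriv Ψ (u x) • Du x)) := lintegral_mono_ae hpt
    _ = ENNReal.ofReal (K / α) *
        ENNReal.ofReal (∫ x in Ω, a x (u x) * inner ℝ (Du x) (deriv Ψ (u x) • Du x)) := by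
        rw [lintegral_const_mul' _ _ ENNReal.ofReal_ne_top, ofReal_integral_eq_lintegral_ofReal hint]
        filter_upwards [hab] with x hx
        have ha0 : 0 ≤ a x (u x) :=
          (div_nonneg hα.le (degeneracy_weight_pos _ _).le).trans (hx (u x)).1
        rw [hinner]
        exact mul_nonneg ha0 (mul_nonneg (hΨ0 _) (by positivity))
    _ ≤ ENNReal.ofReal (K / α) * ∫⁻ x in Ω, ‖f x‖ₑ * ‖Ψ (u x)‖ₑ := by
        gcongr
        rw [hsol _ _ hv]
        calc ENNReal.ofReal (∫ x in Ω, f x * Ψ (u x)) ≤ ‖∫ x in Ω, f x * Ψ (u x)‖ₑ :=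
              Real.ofReal_le_enorm _
          _ ≤ ∫⁻ x in Ω, ‖f x * Ψ (u x)‖ₑ := enorm_integral_le_lintegral_enorm _
          _ = _ := by simp only [enorm_mul]

theorem exists_smoothTransition_deriv_le :
    ∃ M : ℝ, 0 < M ∧ ∀ x, deriv Real.smoothTransition x ≤ M := by
  have hc : Continuous (deriv Real.smoothTransition) :=
    (Real.smoothTransition.contDiff (n := 1)).continuous_deriv (by simp)
  obtain ⟨M, hM⟩ := (isCompact_Icc (a := (0 : ℝ)) (b := 1)).exists_bound_of_continuousOn
    hc.continuousOn
  refine ⟨max M 1, by positivity, fun x => ?_⟩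
  by_cases hx : x ∈ Set.Icc (0 : ℝ) 1
  · exact (le_abs_self _).trans ((hM x hx).trans (le_max_left _ _))
  · have : deriv Real.smoothTransition x = 0 := by
      rw [Set.mem_Icc, not_and_or, not_le, not_le] at hx
      rcases hx with hx | hx
      · have : Real.smoothTransition =ᶠ[𝓝 x] fun _ => 0 := by
          filter_upwards [eventually_lt_nhds hx] with y hy
          exact Real.smoothTransition.zero_of_nonpos hy.le
        rw [this.deriv_eq, deriv_const]
      · have : Real.smoothTransition =ᶠ[𝓝 x] fun _ => 1 := by
          filter_upwards [eventually_gt_nhds hx] with y hy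
          exact Real.smoothTransition.one_of_one_le hy.le
        rw [this.deriv_eq, deriv_const]
    rw [this]
    positivity

/-- A smooth odd cutoff, vanishing on `[-k, k]` and equal to `±1` outside `(-(k + δ), k + δ)`. -/
noncomputable def oddCutoff (k δ s : ℝ) : ℝ :=
  Real.smoothTransition ((s - k) / δ) - Real.smoothTransition ((-s - k) / δ)

theorem contDiff_oddCutoff (k δ : ℝ) : ContDiff ℝ (⊤ : ℕ∞) (oddCutoff k δ) :=
  (Real.smoothTransition.contDiff.comp (by fun_prop)).sub
    (Real.smoothTransition.contDiff.comp (by fun_prop))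

theorem oddCutoff_eq_zero {k δ s : ℝ} (hδ : 0 < δ) (hs : |s| ≤ k) : oddCutoff k δ s = 0 := by
  obtain ⟨h1, h2⟩ := abs_le.1 hs
  rw [oddCutoff, Real.smoothTransition.zero_of_nonpos (div_nonpos_of_nonpos_of_nonneg
    (by linarith) hδ.le), Real.smoothTransition.zero_of_nonpos (div_nonpos_of_nonpos_of_nonneg
    (by linarith) hδ.le), sub_zero]

theorem abs_oddCutoff_le_one (k δ s : ℝ) : |oddCutoff k δ s| ≤ 1 := by
  have h1 := Real.smoothTransition.le_one ((s - k) / δ)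
  have h2 := Real.smoothTransition.nonneg ((s - k) / δ)
  have h3 := Real.smoothTransition.le_one ((-s - k) / δ)
  have h4 := Real.smoothTransition.nonneg ((-s - k) / δ)
  rw [abs_le, oddCutoff]
  constructor <;> linarith

theorem abs_oddCutoff_eq_one {k δ s : ℝ} (hk : 0 ≤ k) (hδ : 0 < δ) (hs : k + δ ≤ |s|) :
    |oddCutoff k δ s| = 1 := by
  rcases le_abs.1 hs with h | h
  · rw [oddCutoff, Real.smoothTransition.one_of_one_le (by rw [le_div_iff₀ hδ]; linarith),
      Real.smoothTransition.zero_of_nonpos (div_nonpos_of_nonpos_of_nonneg (by linarith) hδ.le)]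
    simp
  · rw [oddCutoff, Real.smoothTransition.one_of_one_le (x := (-s - k) / δ)
      (by rw [le_div_iff₀ hδ]; linarith),
      Real.smoothTransition.zero_of_nonpos (div_nonpos_of_nonpos_of_nonneg (by linarith) hδ.le)]
    simp

theorem hasDerivAt_oddCutoff (k δ s : ℝ) :
    HasDerivAt (oddCutoff k δ) ((deriv Real.smoothTransition ((s - k) / δ) +
      deriv Real.smoothTransition ((-s - k) / δ)) / δ) s := by
  have hT : Differentiable ℝ Real.smoothTransition :=
    (Real.smoothTransition.contDiff (n := 1)).differentiable (by simp)
  have h1 := (hT ((s - k) / δ)).hasDerivAt.comp s (((hasDerivAt_id s).sub_const k).div_const δ)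
  have h2 := (hT ((-s - k) / δ)).hasDerivAt.comp s
    ((((hasDerivAt_id s).neg).sub_const k).div_const δ)
  convert! h1.sub h2 using 1
  ring

theorem deriv_oddCutoff_nonneg (k s : ℝ) {δ : ℝ} (hδ : 0 < δ) : 0 ≤ deriv (oddCutoff k δ) s := by
  rw [(hasDerivAt_oddCutoff k δ s).deriv]
  exact div_nonneg (add_nonneg Real.smoothTransition.monotone.deriv_nonneg
    Real.smoothTransition.monotone.deriv_nonneg) hδ.le

theorem deriv_oddCutoff_le {M : ℝ} (hM : ∀ x, deriv Real.smoothTransition x ≤ M) (k s : ℝ) {δ : ℝ}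
    (hδ : 0 < δ) : deriv (oddCutoff k δ) s ≤ 2 * M / δ := by
  rw [(hasDerivAt_oddCutoff k δ s).deriv]
  gcongr
  linarith [hM ((s - k) / δ), hM ((-s - k) / δ)]

end WeakSolution

/-! ### Decay of the level sets -/

/-- The level sets of `G(u)` decay at Stampacchia's rate, with a constant independent of the
domain and of the coefficient. -/
theorem exists_levelDecay (n : ℕ) (hn : 2 < n) {α : ℝ} (hα : 0 < α) {K : ℝ} (hK : 0 < K) {m : ℝ}
    (hm : 1 < m) {γ : ℝ} (hγ : 0 < γ) :
    ∃ D : ℝ, 0 < D ∧ ∀ (θ : ℝ), 0 ≤ θ → ∀ (β : ℝ) (Ω : Set (EuclideanSpace ℝ (Fin n))),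
      IsOpen Ω → Bornology.IsBounded Ω →
      ∀ a : EuclideanSpace ℝ (Fin n) → ℝ → ℝ, IsCaratheodory Ω a → DegenerateBounds Ω α β θ a →
      ∀ f : EuclideanSpace ℝ (Fin n) → ℝ, AEMeasurable f (volume.restrict Ω) →
      WeakBound m Ω f γ →
      ∀ u : EuclideanSpace ℝ (Fin n) → ℝ, IsWeakSolution Ω a f u →
      ∀ G : ℝ → ℝ, ContDiff ℝ (⊤ : ℕ∞) G → G 0 = 0 → (∀ s, 0 ≤ deriv G s) →
      (∀ s, deriv G s ≤ K / ((1 + |s|) ^ θ * Real.log (Real.exp 1 + |s|) ^ θ)) →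
      LevelDecay D (n / (n - 2)) ((1 - 1 / m) * (n / (n - 2)))
        (fun t => (volume.restrict Ω).real {x | t < |G (u x)|}) := by
  obtain ⟨S, hS⟩ := exists_sobolev_const n hn
  obtain ⟨M, hM0, hM⟩ := exists_smoothTransition_deriv_le
  have hn' : (2 : ℝ) < n := by exact_mod_cast hn
  have hn2 : (0 : ℝ) < n - 2 := by linarith
  set q : ℝ := n / (n - 2)
  have hq : 0 < q := by positivity
  have hm1 : 0 < m - 1 := by linarith
  have hm0 : 0 < m := by linarith
  set c : ℝ := 2 * M * K / α * (m / (m - 1) * γ ^ (1 / m)) with hc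
  have hc0 : 0 < c := by positivity
  -- The `+ 1` keeps the constant positive even if `S = 0`.
  refine ⟨(((S : ℝ) ^ 2 + 1) * c) ^ q, by positivity, ?_⟩
  intro θ hθ β Ω hΩ hΩb a ha hab f hf hfw u hsol G hG hG0 hG' hGK
  obtain ⟨Du, hu, hsol⟩ := hsol
  have : IsFiniteMeasure (volume.restrict Ω) := ⟨by simpa using hΩb.measure_lt_top⟩
  set ν := volume.restrict Ω
  refine ⟨fun t => measureReal_nonneg, fun s t hst => measureReal_mono fun x hx => hst.trans_lt hx,
    fun k δ hk hδ => ?_⟩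
  set Ψ : ℝ → ℝ := fun s => oddCutoff k δ (G s)
  have hGd : Differentiable ℝ G := hG.differentiable (by simp)
  have hQd : Differentiable ℝ (oddCutoff k δ) := (contDiff_oddCutoff k δ).differentiable (by simp)
  have hΨ' : ∀ s, deriv Ψ s = deriv (oddCutoff k δ) (G s) * deriv G s := fun s =>
    ((hQd (G s)).hasDerivAt.comp s (hGd s).hasDerivAt).deriv
  have hΨ0 : Ψ 0 = 0 := oddCutoff_eq_zero hδ (by simpa [hG0] using hk)
  obtain ⟨hv, henergy⟩ := lintegral_enorm_grad_comp_sq_le (Ψ := Ψ) (K := 2 * M / δ * K) hα hθ ha hab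
    hu hsol ((contDiff_oddCutoff k δ).comp hG) hΨ0 (by positivity)
    (fun s => by
      rw [hΨ']
      exact mul_nonneg (deriv_oddCutoff_nonneg k _ hδ) (hG' s))
    (fun s => by
      rw [hΨ', mul_div_assoc]
      exact mul_le_mul (deriv_oddCutoff_le hM k _ hδ) (hGK s) (hG' s) (by positivity))
  -- As `u` is only a.e. measurable, the superlevel set is replaced by a measurable hull of the same
  -- measure.
  set A := toMeasurable ν {x | k < |G (u x)|}
  have hAm : MeasurableSet A := measurableSet_toMeasurable _ _
  have hAν : ν.real A = ν.real {x | k < |G (u x)|} := by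
    simp only [measureReal_def, A, measure_toMeasurable]
  have hfv : ∫⁻ x in Ω, ‖f x‖ₑ * ‖Ψ (u x)‖ₑ ≤
      ENNReal.ofReal (m / (m - 1) * γ ^ (1 / m) * ν.real {x | k < |G (u x)|} ^ (1 - 1 / m)) := by
    rw [← hAν]
    refine le_trans ?_ (setLIntegral_enorm_le_of_weak_bound hf hm hγ (fun t ht => ?_)
      (measure_ne_top ν A))
    · rw [← lintegral_indicator hAm]
      refine lintegral_mono fun x => ?_
      by_cases hx : x ∈ A
      · rw [Set.indicator_of_mem hx]
        refine mul_le_of_le_one_right zero_le ?_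
        rw [← ofReal_norm, ENNReal.ofReal_le_one]
        exact abs_oddCutoff_le_one _ _ _
      · have h1 : |G (u x)| ≤ k := not_lt.1 fun h => hx (subset_toMeasurable _ _ h)
        have h2 : Ψ (u x) = 0 := oddCutoff_eq_zero hδ h1
        simp [h2]
    · rw [Measure.restrict_apply' hΩ.measurableSet]
      refine (measure_mono ?_).trans (hfw t ht)
      rintro x ⟨h1, h2⟩
      exact ⟨h2, h1⟩
  set V := ν.real {x | k < |G (u x)|}
  have hV : 0 ≤ V := measureReal_nonneg
  have hgrad : eLpNorm (fun x => deriv Ψ (u x) • Du x) 2 ν ^ (2 : ℝ) ≤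
      ENNReal.ofReal (c / δ * V ^ (1 - 1 / m)) := by
    rw [eLpNorm_eq_lintegral_rpow_enorm_toReal (by simp) (by simp), ENNReal.toReal_ofNat,
      ← ENNReal.rpow_mul, one_div_mul_cancel (by norm_num), ENNReal.rpow_one]
    refine henergy.trans ((mul_le_mul_right hfv _).trans (le_of_eq ?_))
    rw [← ENNReal.ofReal_mul (by positivity)]
    congr 1
    rw [hc]
    ring
  have hp : (ENNReal.ofReal (2 * n / (n - 2))).toReal = 2 * q := by
    rw [ENNReal.toReal_ofReal (by positivity)]
    ring
  have hp0 : ENNReal.ofReal (2 * n / (n - 2)) ≠ 0 := by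
    rw [Ne, ENNReal.ofReal_eq_zero, not_le]
    positivity
  -- Chebyshev at height 1, the plateau of the cutoff. The squared gradient norm is of order `δ⁻¹`,
  -- so the power `2q` of the norm yields `δ^{-q}`.
  have hcheb := mul_meas_ge_le_pow_eLpNorm' ν hp0 ENNReal.ofReal_ne_top
    hv.hasW12Gradient.memLp.1 1
  rw [ENNReal.one_rpow, one_mul, hp] at hcheb
  have hmain : ν {x | k + δ < |G (u x)|} ≤
      ENNReal.ofReal ((((S : ℝ) ^ 2 + 1) * c) ^ q * δ ^ (-q) * V ^ ((1 - 1 / m) * q)) := by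
    calc ν {x | k + δ < |G (u x)|} ≤ ν {x | 1 ≤ ‖Ψ (u x)‖ₑ} := by
          refine measure_mono fun x hx => ?_
          have h1 : |Ψ (u x)| = 1 := abs_oddCutoff_eq_one hk hδ (le_of_lt hx)
          rw [Set.mem_ofPred_eq, ← ofReal_norm, Real.norm_eq_abs, h1, ENNReal.ofReal_one]
      _ ≤ _ := hcheb
      _ ≤ (S * eLpNorm (fun x => deriv Ψ (u x) • Du x) 2 ν) ^ (2 * q) := by
          gcongr
          exact hS Ω _ _ hv
      _ = ((S : ENNReal) ^ (2 : ℝ) *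
            eLpNorm (fun x => deriv Ψ (u x) • Du x) 2 ν ^ (2 : ℝ)) ^ q := by
          rw [ENNReal.rpow_mul, ENNReal.mul_rpow_of_nonneg _ _ (by norm_num)]
      _ ≤ (ENNReal.ofReal ((S : ℝ) ^ 2 + 1) * ENNReal.ofReal (c / δ * V ^ (1 - 1 / m))) ^ q := by
          gcongr
          rw [← ENNReal.ofReal_coe_nnreal, ENNReal.ofReal_rpow_of_nonneg S.coe_nonneg (by norm_num),
            Real.rpow_two]
          exact ENNReal.ofReal_le_ofReal (by linarith)
      _ = _ := by
          rw [← ENNReal.ofReal_mul (by positivity),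
            ENNReal.ofReal_rpow_of_nonneg (by positivity) hq.le]
          congr 1
          rw [show ((S : ℝ) ^ 2 + 1) * (c / δ * V ^ (1 - 1 / m)) =
            ((S : ℝ) ^ 2 + 1) * c * δ⁻¹ * V ^ (1 - 1 / m) by ring,
            Real.mul_rpow (by positivity) (by positivity),
            Real.mul_rpow (by positivity) (by positivity), ← Real.rpow_mul hV,
            Real.inv_rpow hδ.le, Real.rpow_neg hδ.le]
  exact ENNReal.toReal_le_of_le_ofReal (by positivity) hmain

/-- The infimum may vanish; adding 1 gives an admissible positive constant that still depends on the
norm alone. -/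
theorem weakBound_weakNorm_rpow_add_one {n : ℕ} {Ω : Set (EuclideanSpace ℝ (Fin n))}
    {f : EuclideanSpace ℝ (Fin n) → ℝ} {m : ℝ} (hm : 0 < m) (hf : MemWeakL m Ω f) :
    0 < weakNorm m Ω f ^ m + 1 ∧ WeakBound m Ω f (weakNorm m Ω f ^ m + 1) := by
  have mono : ∀ {γ γ' : ℝ}, γ ≤ γ' → WeakBound m Ω f γ → WeakBound m Ω f γ' :=
    fun h hw t ht => (hw t ht).trans (ENNReal.ofReal_le_ofReal (by gcongr))
  set s := {γ : ℝ | 0 < γ ∧ WeakBound m Ω f γ} with hs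
  have hne : s.Nonempty := by
    obtain ⟨γ, hγ⟩ := hf.2
    exact ⟨max γ 1, by positivity, mono (le_max_left _ _) hγ⟩
  have h0 : 0 ≤ sInf s := Real.sInf_nonneg fun γ hγ => hγ.1.le
  have hN : weakNorm m Ω f ^ m = sInf s := by
    rw [weakNorm, ← Real.rpow_mul h0, one_div_mul_cancel hm.ne', Real.rpow_one]
  obtain ⟨γ, hγ, hlt⟩ := Real.lt_sInf_add_pos hne one_pos
  rw [hN]
  exact ⟨by linarith, mono hlt.le hγ.2⟩

/-! ### Profiles dominated by the degenerate coefficient -/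

theorem abs_arsinh (s : ℝ) : |Real.arsinh s| = Real.arsinh |s| := by
  rcases le_total 0 s with h | h
  · rw [abs_of_nonneg h, abs_of_nonneg (Real.arsinh_nonneg_iff.2 h)]
  · rw [abs_of_nonpos h, abs_of_nonpos (Real.arsinh_nonpos_iff.2 h), Real.arsinh_neg]

theorem log_exp_one_add_abs_le (s : ℝ) : Real.log (Real.exp 1 + |s|) ≤ 1 + |Real.arsinh s| := by
  rw [abs_arsinh, Real.log_le_iff_le_exp (by positivity), Real.exp_add, Real.exp_arsinh]
  have h1 : 1 ≤ √(1 + |s| ^ 2) := Real.one_le_sqrt.2 (by simp [sq_nonneg])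
  have h2 : 1 ≤ Real.exp 1 := Real.one_le_exp zero_le_one
  nlinarith [abs_nonneg s, Real.exp_pos 1]

theorem one_add_abs_le_two_mul_sqrt (s : ℝ) : 1 + |s| ≤ 2 * √(1 + s ^ 2) := by
  have h1 : 1 ≤ √(1 + s ^ 2) := Real.one_le_sqrt.2 (by simp [sq_nonneg])
  have h2 : |s| ≤ √(1 + s ^ 2) := Real.abs_le_sqrt (by linarith)
  linarith

theorem hasDerivAt_arsinh_arsinh (s : ℝ) :
    HasDerivAt (fun s => Real.arsinh (Real.arsinh s))
      ((√(1 + Real.arsinh s ^ 2))⁻¹ * (√(1 + s ^ 2))⁻¹) s :=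
  (Real.hasDerivAt_arsinh (Real.arsinh s)).comp s (Real.hasDerivAt_arsinh s)

/-- `arsinh ∘ arsinh` is dominated by the degenerate coefficient, uniformly in `θ ∈ [0, 1]`. -/
theorem deriv_arsinh_arsinh_le {θ : ℝ} (hθ1 : θ ≤ 1) (s : ℝ) :
    deriv (fun s => Real.arsinh (Real.arsinh s)) s ≤
      4 / ((1 + |s|) ^ θ * Real.log (Real.exp 1 + |s|) ^ θ) := by
  rw [(hasDerivAt_arsinh_arsinh s).deriv, ← mul_inv, ← one_div,
    div_le_div_iff₀ (by positivity) (degeneracy_weight_pos s θ), one_mul]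
  have h1 : (1 + |s|) ^ θ ≤ 1 + |s| :=
    Real.rpow_le_self_of_one_le (by linarith [abs_nonneg s]) hθ1
  have hl := one_le_log_exp_one_add_abs s
  have h2 : Real.log (Real.exp 1 + |s|) ^ θ ≤ Real.log (Real.exp 1 + |s|) :=
    Real.rpow_le_self_of_one_le hl hθ1
  calc (1 + |s|) ^ θ * Real.log (Real.exp 1 + |s|) ^ θ
      ≤ (1 + |s|) * Real.log (Real.exp 1 + |s|) :=
        mul_le_mul h1 h2 (Real.rpow_nonneg (by linarith) _) (by positivity)
    _ ≤ (2 * √(1 + s ^ 2)) * (2 * √(1 + Real.arsinh s ^ 2)) :=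
        mul_le_mul (one_add_abs_le_two_mul_sqrt s)
          ((log_exp_one_add_abs_le s).trans (one_add_abs_le_two_mul_sqrt _)) (by linarith)
          (by positivity)
    _ = _ := by ring

/-- A logarithm costs an arbitrarily small power: `ln x ≤ x^ε / ε`, with `ε` small enough that `θ +
ε θ ≤ τ`. -/
theorem exists_degeneracy_weight_le {θ τ : ℝ} (hθ : 0 ≤ θ) (hτ : θ < τ) :
    ∃ K : ℝ, 0 < K ∧ ∀ s : ℝ,
      (1 + |s|) ^ θ * Real.log (Real.exp 1 + |s|) ^ θ ≤ K * (1 + s ^ 2) ^ (τ / 2) := by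
  set ε := (τ - θ) / (θ + 1) with hε
  have hε0 : 0 < ε := div_pos (by linarith) (by linarith)
  have hexp : θ + ε * θ ≤ τ := by
    have : ε * (θ + 1) = τ - θ := by rw [hε]; field_simp
    linarith
  refine ⟨(1 / ε) ^ θ * (2 * Real.exp 1) ^ τ, by positivity, fun s => ?_⟩
  have he : 1 ≤ Real.exp 1 := Real.one_le_exp zero_le_one
  have hx1 : 1 ≤ Real.exp 1 + |s| := by linarith [abs_nonneg s]
  have hx0 : 0 < Real.exp 1 + |s| := by linarith
  have hlog : Real.log (Real.exp 1 + |s|) ≤ 1 / ε * (Real.exp 1 + |s|) ^ ε := by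
    rw [one_div_mul_eq_div]
    exact Real.log_le_rpow_div hx0.le hε0
  have hsq : Real.exp 1 + |s| ≤ 2 * Real.exp 1 * (1 + s ^ 2) ^ (1 / 2 : ℝ) := by
    rw [← Real.sqrt_eq_rpow]
    have h1 := one_add_abs_le_two_mul_sqrt s
    nlinarith [abs_nonneg s]
  calc (1 + |s|) ^ θ * Real.log (Real.exp 1 + |s|) ^ θ
      ≤ (Real.exp 1 + |s|) ^ θ * (1 / ε * (Real.exp 1 + |s|) ^ ε) ^ θ := by
        have := one_le_log_exp_one_add_abs s
        gcongr
    _ = (1 / ε) ^ θ * (Real.exp 1 + |s|) ^ (θ + ε * θ) := by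
        rw [Real.mul_rpow (by positivity) (by positivity), ← Real.rpow_mul hx0.le,
          Real.rpow_add hx0]
        ring
    _ ≤ (1 / ε) ^ θ * (Real.exp 1 + |s|) ^ τ := by gcongr
    _ ≤ (1 / ε) ^ θ * (2 * Real.exp 1 * (1 + s ^ 2) ^ (1 / 2 : ℝ)) ^ τ := by
        have : 0 ≤ τ := by linarith
        gcongr
    _ = _ := by
        rw [Real.mul_rpow (by positivity) (by positivity), ← Real.rpow_mul (by positivity),
          mul_assoc, one_div_mul_eq_div 2 τ]

/-- A smooth function growing like `|s|^{1 - τ}` which is dominated by the degenerate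
coefficient. -/
theorem exists_power_profile {θ τ : ℝ} (hθ : 0 ≤ θ) (hτ : θ < τ) (hτ1 : τ < 1) :
    ∃ (K : ℝ) (G : ℝ → ℝ), 0 < K ∧ ContDiff ℝ (⊤ : ℕ∞) G ∧ G 0 = 0 ∧ (∀ s, 0 ≤ deriv G s) ∧
      (∀ s, deriv G s ≤ K / ((1 + |s|) ^ θ * Real.log (Real.exp 1 + |s|) ^ θ)) ∧
      ∀ s, 1 ≤ |s| → |s| ^ (1 - τ) / 2 ≤ |G s| := by
  obtain ⟨K, hK, hW⟩ := exists_degeneracy_weight_le hθ hτ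
  have hp : ∀ s : ℝ, 0 < 1 + s ^ 2 := fun s => by positivity
  have hτ0 : 0 < τ := by linarith
  have hd : ∀ s : ℝ, HasDerivAt (fun s : ℝ => s * (1 + s ^ 2) ^ (-(τ / 2)))
      ((1 + s ^ 2) ^ (-(τ / 2)) * (1 - τ * (s ^ 2 / (1 + s ^ 2)))) s := by
    intro s
    have h1 : HasDerivAt (fun s : ℝ => 1 + s ^ 2) (2 * s) s := by
      simpa using (hasDerivAt_pow 2 s).const_add 1
    have h2 := (hasDerivAt_id s).mul (h1.rpow_const (p := -(τ / 2)) (Or.inl (hp s).ne'))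
    refine h2.congr_deriv ?_
    rw [Real.rpow_sub_one (hp s).ne']
    have := (hp s).ne'
    simp only [id_eq]
    field_simp
    ring
  have hfrac : ∀ s : ℝ, 0 ≤ s ^ 2 / (1 + s ^ 2) ∧ s ^ 2 / (1 + s ^ 2) ≤ 1 := fun s =>
    ⟨by positivity, (div_le_one (hp s)).2 (by linarith)⟩
  -- Its derivative is `(1 + s²)^{-τ/2}` times a factor in `[0, 1]` because `0 < τ < 1`, which gives
  -- both the monotonicity and the domination.
  refine ⟨K, fun s => s * (1 + s ^ 2) ^ (-(τ / 2)), hK, ?_, by simp, fun s => ?_, fun s => ?_,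
    fun s hs => ?_⟩
  · exact contDiff_id.mul ((contDiff_const.add (contDiff_id.pow 2)).rpow_const_of_ne
      fun s => (hp s).ne')
  · rw [(hd s).deriv]
    have := hfrac s
    exact mul_nonneg (Real.rpow_nonneg (hp s).le _) (by nlinarith)
  · rw [(hd s).deriv, le_div_iff₀ (degeneracy_weight_pos s θ)]
    have h1 : (1 + s ^ 2) ^ (-(τ / 2)) * (1 - τ * (s ^ 2 / (1 + s ^ 2))) ≤
        (1 + s ^ 2) ^ (-(τ / 2)) :=
      mul_le_of_le_one_right (Real.rpow_nonneg (hp s).le _)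
        (by linarith [mul_nonneg hτ0.le (hfrac s).1])
    calc _ ≤ (1 + s ^ 2) ^ (-(τ / 2)) * (K * (1 + s ^ 2) ^ (τ / 2)) :=
          mul_le_mul h1 (hW s) (degeneracy_weight_pos s θ).le (Real.rpow_nonneg (hp s).le _)
      _ = K := by
          rw [mul_left_comm, ← Real.rpow_add (hp s)]
          simp
  · have hs0 : 0 < |s| := by linarith
    have h1 : (1 + s ^ 2) ^ (τ / 2) ≤ 2 * |s| ^ τ := by
      calc (1 + s ^ 2) ^ (τ / 2) ≤ (2 * |s| ^ 2) ^ (τ / 2) := by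
            rw [← sq_abs s]
            gcongr
            nlinarith
        _ = 2 ^ (τ / 2) * |s| ^ τ := by
            rw [Real.mul_rpow (by norm_num) (by positivity), ← Real.rpow_natCast,
              ← Real.rpow_mul hs0.le]
            congr 2
            push_cast
            ring
        _ ≤ 2 * |s| ^ τ := by
            gcongr
            exact Real.rpow_le_self_of_one_le (by norm_num) (by linarith)
    rw [abs_mul, abs_of_nonneg (Real.rpow_nonneg (hp s).le _), Real.rpow_neg (hp s).le,
      Real.rpow_sub hs0, Real.rpow_one, div_div, ← div_eq_mul_inv]
    gcongr
    linarith

/-- Beyond the crossover `Y`, where `η Y^{σ-ρ} = 1`, the higher power wins; below it `x^ρ ≤ Y^ρ`. -/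
theorem exists_rpow_le_add_mul_rpow {ρ σ η : ℝ} (hρ : 0 < ρ) (hσ : ρ < σ) (hη : 0 < η) :
    ∃ C : ℝ, ∀ x : ℝ, 0 < x → x ^ ρ ≤ C + η * x ^ σ := by
  have h0 : 0 < σ - ρ := by linarith
  set Y := (1 / η) ^ (1 / (σ - ρ))
  have hY : 0 < Y := by positivity
  refine ⟨Y ^ ρ, fun x hx => ?_⟩
  rcases le_total x Y with h | h
  · have := Real.rpow_le_rpow hx.le h hρ.le
    have : 0 ≤ η * x ^ σ := by positivity
    linarith
  · have h1 : 1 / η ≤ x ^ (σ - ρ) := by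
      calc 1 / η = Y ^ (σ - ρ) := by
            rw [← Real.rpow_mul (by positivity), one_div_mul_cancel h0.ne', Real.rpow_one]
        _ ≤ _ := by gcongr
    have h2 : x ^ σ = x ^ (σ - ρ) * x ^ ρ := by rw [← Real.rpow_add hx]; ring_nf
    have h3 : 1 ≤ η * x ^ (σ - ρ) := by
      rw [div_le_iff₀ hη] at h1
      linarith
    have h4 : 0 < x ^ ρ := by positivity
    have h5 : 0 < Y ^ ρ := by positivity
    rw [h2]
    nlinarith

/-- Layer cake: exponentiating at half the decay rate leaves the integrable tail `e^{-ζt/2}`. -/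
theorem integrable_exp_of_measure_lt_le_exp {X : Type*} [MeasurableSpace X] {ν : Measure X}
    [IsFiniteMeasure ν] {w : X → ℝ} (hw : AEMeasurable w ν) (hw0 : ∀ x, 0 ≤ w x) {C ζ : ℝ}
    (hζ : 0 < ζ) (h : ∀ t, 0 ≤ t → ν.real {x | t < w x} ≤ C * Real.exp (-(ζ * t))) :
    Integrable (fun x => Real.exp (ζ / 2 * w x)) ν := by
  have hderiv : ∀ t : ℝ,
      HasDerivAt (fun t => Real.exp (ζ / 2 * t)) (ζ / 2 * Real.exp (ζ / 2 * t)) t := by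
    intro t
    have := ((hasDerivAt_id t).const_mul (ζ / 2)).exp
    simpa [mul_comm] using this
  have hcont : Continuous fun t : ℝ => ζ / 2 * Real.exp (ζ / 2 * t) := by fun_prop
  have hFTC : ∀ y : ℝ, ∫ t in (0 : ℝ)..y, ζ / 2 * Real.exp (ζ / 2 * t) =
      Real.exp (ζ / 2 * y) - 1 := by
    intro y
    rw [intervalIntegral.integral_eq_sub_of_hasDerivAt (fun t _ => hderiv t)
      (hcont.intervalIntegrable _ _)]
    simp
  have hlc := lintegral_comp_eq_lintegral_meas_lt_mul ν (Eventually.of_forall hw0) hw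
    (g := fun t => ζ / 2 * Real.exp (ζ / 2 * t)) (fun t _ => hcont.intervalIntegrable _ _)
    (Eventually.of_forall fun t => by positivity)
  simp only [hFTC] at hlc
  have hfin : ∫⁻ x, ENNReal.ofReal (Real.exp (ζ / 2 * w x) - 1) ∂ν < ⊤ := by
    rw [hlc]
    have hI : IntegrableOn (fun t : ℝ => C * (ζ / 2) * Real.exp (-(ζ / 2) * t)) (Set.Ioi 0) :=
      (exp_neg_integrableOn_Ioi 0 (by positivity)).const_mul _
    refine lt_of_le_of_lt (setLIntegral_mono' measurableSet_Ioi fun t ht => ?_)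
      (hI.lintegral_lt_top)
    have ht0 : 0 ≤ t := le_of_lt ht
    rw [← ofReal_measureReal, ← ENNReal.ofReal_mul measureReal_nonneg]
    refine ENNReal.ofReal_le_ofReal ?_
    calc ν.real {x | t < w x} * (ζ / 2 * Real.exp (ζ / 2 * t))
        ≤ C * Real.exp (-(ζ * t)) * (ζ / 2 * Real.exp (ζ / 2 * t)) := by
          gcongr
          exact h t ht0
      _ = C * (ζ / 2) * (Real.exp (-(ζ * t)) * Real.exp (ζ / 2 * t)) := by ring
      _ = _ := by
          rw [← Real.exp_add]
          ring_nf
  have hmeas : AEStronglyMeasurable (fun x => Real.exp (ζ / 2 * w x) - 1) ν :=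
    ((Real.measurable_exp.comp_aemeasurable (hw.const_mul _)).sub_const 1).aestronglyMeasurable
  have hint : Integrable (fun x => Real.exp (ζ / 2 * w x) - 1) ν := by
    refine ⟨hmeas, ?_⟩
    rw [hasFiniteIntegral_iff_ofReal (Eventually.of_forall fun x => ?_)]
    · exact hfin
    · have := hw0 x
      simp only [Pi.zero_apply, sub_nonneg, Real.one_le_exp_iff]
      positivity
  refine (hint.add (integrable_const (1 : ℝ))).congr (Eventually.of_forall fun x => ?_)
  simp

/-! ### The three regimes of `m` -/

section WeakSolution

variable {n : ℕ}

theorem IsWeakSolution.aemeasurable {Ω : Set (EuclideanSpace ℝ (Fin n))}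
    {a : EuclideanSpace ℝ (Fin n) → ℝ → ℝ} {f u : EuclideanSpace ℝ (Fin n) → ℝ}
    (h : IsWeakSolution Ω a f u) : AEMeasurable u (volume.restrict Ω) := by
  obtain ⟨Du, hu, -⟩ := h
  exact hu.hasW12Gradient.memLp.1.aemeasurable

/-- Boundedness of weak solutions for `m > n / 2`. -/
theorem exists_bound_of_half_dim_lt (hn : 2 < n) {α : ℝ} (hα : 0 < α) {m : ℝ} (hm : 1 < m)
    (hmn : (n : ℝ) / 2 < m) (N V : ℝ) :
    ∃ L : ℝ, 0 < L ∧ ∀ θ : ℝ, 0 ≤ θ → θ < 1 →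
      ∀ (β : ℝ) (Ω : Set (EuclideanSpace ℝ (Fin n))), IsOpen Ω → Bornology.IsBounded Ω →
        volume.real Ω = V →
      ∀ a : EuclideanSpace ℝ (Fin n) → ℝ → ℝ, IsCaratheodory Ω a → DegenerateBounds Ω α β θ a →
      ∀ f : EuclideanSpace ℝ (Fin n) → ℝ, MemWeakL m Ω f → weakNorm m Ω f = N →
      ∀ u : EuclideanSpace ℝ (Fin n) → ℝ, IsWeakSolution Ω a f u →
        ∀ᵐ x ∂(volume.restrict Ω), |u x| ≤ L := by
  have hn' : (2 : ℝ) < n := by exact_mod_cast hn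
  have hn2 : (0 : ℝ) < n - 2 := by linarith
  -- Both `K = 4` and `γ` are fixed before `θ`, `Ω` and `f`, so `D` is uniform in them; the absolute
  -- value keeps `γ` positive for an arbitrary real `N`.
  obtain ⟨D, hD, hdecay⟩ := exists_levelDecay n hn hα (K := 4) (by norm_num) hm
    (γ := |N ^ m| + 1) (by positivity)
  have hb : 1 < (1 - 1 / m) * ((n : ℝ) / (n - 2)) := by
    rw [← mul_div_assoc, one_lt_div hn2]
    have : (n : ℝ) / m < 2 := by rw [div_lt_iff₀ (by linarith)]; linarith
    have : (1 - 1 / m) * (n : ℝ) = n - n / m := by ring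
    linarith
  obtain ⟨d, hd, hvan⟩ := exists_levelDecay_eq_zero hD (a := (n : ℝ) / (n - 2)) (by positivity) hb V
  -- The inverse of the profile `arsinh ∘ arsinh` at the level `d` where the measure vanishes.
  refine ⟨Real.sinh (Real.sinh d), Real.sinh_pos_iff.2 (Real.sinh_pos_iff.2 hd), ?_⟩
  intro θ hθ hθ1 β Ω hΩ hΩb hV a ha hab f hf hN u hu
  have : IsFiniteMeasure (volume.restrict Ω) := ⟨by simpa using hΩb.measure_lt_top⟩
  obtain ⟨-, hw⟩ := weakBound_weakNorm_rpow_add_one (by linarith) hf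
  rw [hN] at hw
  have hφ := hdecay θ hθ β Ω hΩ hΩb a ha hab f hf.1
    (fun t ht => (hw t ht).trans (ENNReal.ofReal_le_ofReal (by gcongr; exact le_abs_self _)))
    u hu (fun s => Real.arsinh (Real.arsinh s)) (Real.contDiff_arsinh.comp Real.contDiff_arsinh)
    (by simp) (fun s => by
      rw [(hasDerivAt_arsinh_arsinh s).deriv]
      positivity) (deriv_arsinh_arsinh_le hθ1.le)
  have hzero := hvan _ hφ (by
    rw [← hV]
    refine (measureReal_mono (Set.subset_univ _)).trans (le_of_eq ?_)
    simp [measureReal_def])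
  have hnull := (measureReal_eq_zero_iff).1 hzero
  filter_upwards [measure_eq_zero_iff_ae_notMem.1 hnull] with x hx
  have h1 : |Real.arsinh (Real.arsinh (u x))| ≤ d := not_lt.1 hx
  rw [abs_arsinh, abs_arsinh] at h1
  rwa [← Real.sinh_arsinh |u x|, Real.sinh_le_sinh, ← Real.sinh_arsinh (Real.arsinh |u x|),
    Real.sinh_le_sinh]

/-- Exponential integrability of weak solutions for `m = n / 2`. -/
theorem integrableOn_exp_of_eq_half_dim (hn : 2 < n) {α : ℝ} (hα : 0 < α) {m : ℝ} (hm : 1 < m)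
    (hmn : m = (n : ℝ) / 2) {θ : ℝ} (hθ : 0 ≤ θ) {ρ : ℝ} (hρ : 0 < ρ) (hρθ : ρ < 1 - θ) {β : ℝ}
    {Ω : Set (EuclideanSpace ℝ (Fin n))} (hΩ : IsOpen Ω) (hΩb : Bornology.IsBounded Ω)
    {a : EuclideanSpace ℝ (Fin n) → ℝ → ℝ} (ha : IsCaratheodory Ω a)
    (hab : DegenerateBounds Ω α β θ a) {f : EuclideanSpace ℝ (Fin n) → ℝ} (hf : MemWeakL m Ω f)
    {u : EuclideanSpace ℝ (Fin n) → ℝ} (hu : IsWeakSolution Ω a f u) :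
    IntegrableOn (fun x => Real.exp (|u x| ^ ρ)) Ω volume := by
  have hn' : (2 : ℝ) < n := by exact_mod_cast hn
  have hn2 : (0 : ℝ) < n - 2 := by linarith
  have : IsFiniteMeasure (volume.restrict Ω) := ⟨by simpa using hΩb.measure_lt_top⟩
  -- This makes `ρ < 1 - τ`, so `|u|^ρ` is of lower order than `|G(u)|`, which grows like
  -- `|u|^{1-τ}`.
  obtain ⟨τ, hτ, hτρ⟩ := exists_between (show θ < 1 - ρ by linarith)
  obtain ⟨K, G, hK, hG, hG0, hG', hGK, hGl⟩ := exists_power_profile hθ hτ (by linarith)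
  obtain ⟨hγ, hw⟩ := weakBound_weakNorm_rpow_add_one (by linarith) hf
  obtain ⟨D, hD, hdecay⟩ := exists_levelDecay n hn hα hK hm hγ
  have hφ := hdecay θ hθ β Ω hΩ hΩb a ha hab f hf.1 hw u hu G hG hG0 hG' hGK
  have hb : (1 - 1 / m) * ((n : ℝ) / (n - 2)) = 1 := by
    rw [hmn]
    field_simp
  rw [hb] at hφ
  obtain ⟨C, ζ, -, hζ, hexp⟩ := hφ.exists_le_exp hD (by positivity)
  have hum := hu.aemeasurable
  have hint := integrable_exp_of_measure_lt_le_exp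
    (hG.continuous.measurable.comp_aemeasurable hum).norm (fun x => norm_nonneg _) hζ hexp
  -- The coefficient `ζ/4` matches the available exponent `ζ/2 |G(u)|`, since `|G(u)| ≥ |u|^{1-τ} /
  -- 2` where `|u| ≥ 1`.
  obtain ⟨C', hC'⟩ := exists_rpow_le_add_mul_rpow hρ (show ρ < 1 - τ by linarith)
    (show 0 < ζ / 4 by positivity)
  refine (hint.const_mul (Real.exp (|C'| + 1))).mono'
    (Real.measurable_exp.comp_aemeasurable
      (hum.norm.pow_const ρ)).aestronglyMeasurable (Eventually.of_forall fun x => ?_)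
  rw [Real.norm_of_nonneg (Real.exp_pos _).le, ← Real.exp_add, Real.exp_le_exp]
  have hG0 : 0 ≤ |G (u x)| := abs_nonneg _
  simp only [Function.comp_apply, Real.norm_eq_abs]
  rcases le_total 1 |u x| with h | h
  · have h1 := hC' |u x| (by linarith)
    have h2 := hGl (u x) h
    have h3 : ζ / 4 * |u x| ^ (1 - τ) = ζ / 2 * (|u x| ^ (1 - τ) / 2) := by ring
    have h4 : ζ / 2 * (|u x| ^ (1 - τ) / 2) ≤ ζ / 2 * |G (u x)| := by gcongr
    linarith [le_abs_self C']
  · have h1 : |u x| ^ ρ ≤ 1 := Real.rpow_le_one (abs_nonneg _) h hρ.le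
    have h2 : 0 ≤ ζ / 2 * |G (u x)| := by positivity
    linarith [abs_nonneg C']

/-- Marcinkiewicz regularity of weak solutions for `m < n / 2`. -/
theorem memWeakL_mul_log_of_lt_half_dim (hn : 2 < n) {α : ℝ} (hα : 0 < α) {m : ℝ} (hm : 1 < m)
    (hmn : m < (n : ℝ) / 2) {θ : ℝ} (hθ : 0 ≤ θ) {r : ℝ} (hr : 0 < r)
    (hrθ : r < (n : ℝ) * m / ((n : ℝ) - 2 * m) * (1 - θ)) {β : ℝ}
    {Ω : Set (EuclideanSpace ℝ (Fin n))} (hΩ : IsOpen Ω) (hΩb : Bornology.IsBounded Ω)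
    {a : EuclideanSpace ℝ (Fin n) → ℝ → ℝ} (ha : IsCaratheodory Ω a)
    (hab : DegenerateBounds Ω α β θ a) {f : EuclideanSpace ℝ (Fin n) → ℝ} (hf : MemWeakL m Ω f)
    {u : EuclideanSpace ℝ (Fin n) → ℝ} (hu : IsWeakSolution Ω a f u) :
    MemWeakL r Ω (fun x => |u x| * Real.log (Real.exp 1 + |u x|)) := by
  have hn' : (2 : ℝ) < n := by exact_mod_cast hn
  have hn2 : (0 : ℝ) < n - 2 := by linarith
  have hnm : (0 : ℝ) < n - 2 * m := by linarith
  have hm0 : 0 < m := by linarith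
  have : IsFiniteMeasure (volume.restrict Ω) := ⟨by simpa using hΩb.measure_lt_top⟩
  set q := (n : ℝ) * m / ((n : ℝ) - 2 * m) with hq
  have hq0 : 0 < q := by positivity
  obtain ⟨τ, hτ, hτr⟩ := exists_between (show θ < 1 - r / q by
    have : r / q < 1 - θ := by rw [div_lt_iff₀ hq0]; linarith
    linarith)
  have hrq : r / q < 1 - τ := by linarith
  have hτ1 : 0 < 1 - τ := lt_trans (by positivity) hrq
  obtain ⟨K, G, hK, hG, hG0, hG', hGK, hGl⟩ := exists_power_profile hθ hτ (by linarith)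
  obtain ⟨hγ, hw⟩ := weakBound_weakNorm_rpow_add_one hm0 hf
  obtain ⟨D, hD, hdecay⟩ := exists_levelDecay n hn hα hK hm hγ
  have hφ := hdecay θ hθ β Ω hΩ hΩb a ha hab f hf.1 hw u hu G hG hG0 hG' hGK
  have hb0 : 0 < (1 - 1 / m) * ((n : ℝ) / (n - 2)) := by
    have : 1 / m < 1 := (div_lt_one hm0).2 hm
    have : 0 < 1 - 1 / m := by linarith
    positivity
  have hb : 1 - (1 - 1 / m) * ((n : ℝ) / (n - 2)) = (n - 2 * m) / (m * (n - 2)) := by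
    field_simp
    ring
  have hb1 : (1 - 1 / m) * ((n : ℝ) / (n - 2)) < 1 := by
    have : 0 < (n - 2 * m) / (m * ((n : ℝ) - 2)) := by positivity
    linarith
  obtain ⟨C, hC, hpow⟩ := hφ.exists_le_rpow hD (by positivity) hb0 hb1
  have hexp : (n : ℝ) / (n - 2) / (1 - (1 - 1 / m) * ((n : ℝ) / (n - 2))) = q := by
    rw [hb, hq]
    field_simp
  rw [hexp] at hpow
  -- The surplus power paying for the logarithm, `|u| ln(e + |u|) ≤ C₁ |u|^{1+ε}`, tuned so that the
  -- resulting decay exponent `q (1 - τ) / (1 + ε)` is exactly `r`.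
  set ε := q * (1 - τ) / r - 1
  have hε : 0 < ε := by
    rw [div_lt_iff₀ hq0] at hrq
    have : 1 < q * (1 - τ) / r := by rw [one_lt_div hr]; linarith
    linarith
  have hεr : (1 - τ) / (1 + ε) * q = r := by
    simp only [ε, add_sub_cancel]
    field_simp
  set C₁ := (Real.exp 1 + 1) ^ ε / ε
  have hC₁ : 0 < C₁ := by positivity
  set t₀ := Real.log (Real.exp 1 + 1)
  have hum := hu.aemeasurable
  refine ⟨hum.norm.mul (Real.measurable_log.comp_aemeasurable (hum.norm.const_add _)),
    volume.real Ω * t₀ ^ r + C * 2 ^ q * C₁ ^ r, fun t ht => ?_⟩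
  have ht₀ : 0 < t₀ := Real.log_pos (by linarith [Real.exp_pos 1])
  have htr : 0 < t ^ r := by positivity
  -- Below `t₀ = ln(e + 1)` the measure of `Ω` suffices. Above it the superlevel set lies in `{|u| >
  -- 1}`, where the growth of `G` is available.
  rcases lt_or_ge t t₀ with h | h
  · calc volume {x | x ∈ Ω ∧ t < |(|u x| * Real.log (Real.exp 1 + |u x|))|}
        ≤ volume Ω := measure_mono fun x hx => hx.1
      _ = ENNReal.ofReal (volume.real Ω) := (ENNReal.ofReal_toReal hΩb.measure_lt_top.ne).symm
      _ ≤ _ := by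
        refine ENNReal.ofReal_le_ofReal ?_
        rw [le_div_iff₀ htr]
        have h1 : t ^ r ≤ t₀ ^ r := by gcongr
        have h2 : 0 ≤ C * 2 ^ q * C₁ ^ r := by positivity
        have h3 : volume.real Ω * t ^ r ≤ volume.real Ω * t₀ ^ r := by gcongr
        linarith
  · set k := (t / C₁) ^ ((1 - τ) / (1 + ε)) / 2 with hk
    have hk0 : 0 < k := by positivity
    calc volume {x | x ∈ Ω ∧ t < |(|u x| * Real.log (Real.exp 1 + |u x|))|}
        ≤ volume ({x | k < |G (u x)|} ∩ Ω) := by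
          refine measure_mono fun x ⟨hxΩ, hx⟩ => ⟨?_, hxΩ⟩
          have hlog := one_le_log_exp_one_add_abs (u x)
          rw [abs_of_nonneg (mul_nonneg (abs_nonneg _) (by linarith))] at hx
          have hu1 : 1 < |u x| := by
            by_contra! hle
            have h1 : Real.log (Real.exp 1 + |u x|) ≤ t₀ :=
              Real.log_le_log (by positivity) (by linarith)
            nlinarith [abs_nonneg (u x)]
          have hu0 : 0 < |u x| := by linarith
          have h2 : |u x| * Real.log (Real.exp 1 + |u x|) ≤ C₁ * |u x| ^ (1 + ε) := by
            have h3 : Real.log (Real.exp 1 + |u x|) ≤ C₁ * |u x| ^ ε := by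
              calc Real.log (Real.exp 1 + |u x|) ≤ (Real.exp 1 + |u x|) ^ ε / ε :=
                    Real.log_le_rpow_div (by positivity) hε
                _ ≤ ((Real.exp 1 + 1) * |u x|) ^ ε / ε := by
                    gcongr
                    nlinarith [Real.exp_pos 1]
                _ = C₁ * |u x| ^ ε := by
                    rw [Real.mul_rpow (by positivity) hu0.le]
                    ring
            rw [Real.rpow_add hu0, Real.rpow_one]
            calc _ ≤ |u x| * (C₁ * |u x| ^ ε) := by gcongr
              _ = _ := by ring
          have h4 : t / C₁ < |u x| ^ (1 + ε) := by
            rw [div_lt_iff₀ hC₁]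
            linarith
          have h5 : (t / C₁) ^ ((1 - τ) / (1 + ε)) < |u x| ^ (1 - τ) := by
            calc _ < (|u x| ^ (1 + ε)) ^ ((1 - τ) / (1 + ε)) :=
                  Real.rpow_lt_rpow (by positivity) h4 (by positivity)
              _ = _ := by
                rw [← Real.rpow_mul hu0.le]
                congr 1
                field_simp
          have h6 := hGl (u x) hu1.le
          change k < |G (u x)|
          linarith
      _ = ENNReal.ofReal ((volume.restrict Ω).real {x | k < |G (u x)|}) := by
          rw [ofReal_measureReal, Measure.restrict_apply' hΩ.measurableSet]
      _ ≤ _ := by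
          refine ENNReal.ofReal_le_ofReal ((hpow k hk0).trans ?_)
          have hkq : k ^ (-q) = 2 ^ q * C₁ ^ r / t ^ r := by
            rw [hk, Real.rpow_neg hk0.le, Real.div_rpow (by positivity) (by norm_num),
              ← Real.rpow_mul (by positivity), hεr, Real.div_rpow ht.le hC₁.le]
            field_simp
          rw [hkq, ← mul_div_assoc, ← mul_assoc]
          gcongr
          have : 0 ≤ volume.real Ω * t₀ ^ r := by positivity
          linarith

end WeakSolution

end DegenerateElliptic

theorem mainTheorem4 (n : ℕ) (hn : 2 < n) (α : ℝ) (hα : 0 < α)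
    (μ : ℝ) (hμ : DegenerateElliptic.IsGrowthExponent μ)
    (m : ℝ) (hm : 2 * (n : ℝ) / ((n : ℝ) + 2) < m) :
    -- (i) the bound `L` depends only on `n, α, β, μ, m, N = ‖f‖` and `V = |Ω|`
    ((n : ℝ) / 2 < m → ∀ β : ℝ, 0 < β → ∀ N V : ℝ, ∃ L : ℝ, 0 < L ∧
      ∀ θ : ℝ, 0 ≤ θ → θ < 1 →
      ∀ Ω : Set (EuclideanSpace ℝ (Fin n)), IsOpen Ω → Bornology.IsBounded Ω →
        volume.real Ω = V →
      ∀ a : EuclideanSpace ℝ (Fin n) → ℝ → ℝ, DegenerateElliptic.IsCaratheodory Ω a →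
        DegenerateElliptic.DegenerateBounds Ω α β θ a →
      ∀ f : EuclideanSpace ℝ (Fin n) → ℝ, DegenerateElliptic.MemWeakL m Ω f →
        DegenerateElliptic.weakNorm m Ω f = N →
      ∀ u : EuclideanSpace ℝ (Fin n) → ℝ, DegenerateElliptic.IsWeakSolution Ω a f u →
        ∀ᵐ x ∂(volume.restrict Ω), |u x| ≤ 2 * L) ∧
    -- (ii) the constant `l` depends only on `n, α, μ, m, θ` and `N = ‖f‖`
    (m = (n : ℝ) / 2 → ∀ θ : ℝ, 0 ≤ θ → μ * θ < 1 → ∀ N : ℝ, ∃ l : ℝ, 0 < l ∧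
      ∀ ρ : ℝ, 0 < ρ → ρ < 1 - θ →
      ∀ β : ℝ, 0 < β →
      ∀ Ω : Set (EuclideanSpace ℝ (Fin n)), IsOpen Ω → Bornology.IsBounded Ω →
      ∀ a : EuclideanSpace ℝ (Fin n) → ℝ → ℝ, DegenerateElliptic.IsCaratheodory Ω a →
        DegenerateElliptic.DegenerateBounds Ω α β θ a →
      ∀ f : EuclideanSpace ℝ (Fin n) → ℝ, DegenerateElliptic.MemWeakL m Ω f →
        DegenerateElliptic.weakNorm m Ω f = N →
      ∀ u : EuclideanSpace ℝ (Fin n) → ℝ, DegenerateElliptic.IsWeakSolution Ω a f u →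
        IntegrableOn (fun x => Real.exp (l * |u x| ^ ρ)) Ω volume) ∧
    -- (iii)
    (m < (n : ℝ) / 2 → ∀ θ : ℝ, 0 ≤ θ → θ < 1 →
      ∀ r : ℝ, 0 < r → r < (n : ℝ) * m / ((n : ℝ) - 2 * m) * (1 - θ) →
      ∀ β : ℝ, 0 < β →
      ∀ Ω : Set (EuclideanSpace ℝ (Fin n)), IsOpen Ω → Bornology.IsBounded Ω →
      ∀ a : EuclideanSpace ℝ (Fin n) → ℝ → ℝ, DegenerateElliptic.IsCaratheodory Ω a →
        DegenerateElliptic.DegenerateBounds Ω α β θ a →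
      ∀ f : EuclideanSpace ℝ (Fin n) → ℝ, DegenerateElliptic.MemWeakL m Ω f →
      ∀ u : EuclideanSpace ℝ (Fin n) → ℝ, DegenerateElliptic.IsWeakSolution Ω a f u →
        DegenerateElliptic.MemWeakL r Ω
          (fun x => |u x| * Real.log (Real.exp 1 + |u x|))) := by

  have hn' : (2 : ℝ) < n := by exact_mod_cast hn
  have hm1 : 1 < m := by
    refine lt_trans ?_ hm
    rw [one_lt_div (by linarith)]
    linarith
  refine ⟨fun hmn β _ N V => ?_, fun hmn θ hθ _ N => ?_, ?_⟩
  · obtain ⟨L, hL, h⟩ := DegenerateElliptic.exists_bound_of_half_dim_lt hn hα hm1 hmn N V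
    refine ⟨L / 2, by positivity, fun θ hθ hθ1 Ω hΩ hΩb hV a ha hab f hf hN u hu => ?_⟩
    rw [mul_div_cancel₀ L two_ne_zero]
    exact h θ hθ hθ1 β Ω hΩ hΩb hV a ha hab f hf hN u hu
  -- Because `ρ < 1 - θ` strictly, the lower-order term `|u|^ρ` is absorbed whatever the decay rate,
  -- so 1 serves.
  · refine ⟨1, one_pos, fun ρ hρ hρθ β _ Ω hΩ hΩb a ha hab f hf _ u hu => ?_⟩
    simpa only [one_mul] using DegenerateElliptic.integrableOn_exp_of_eq_half_dim hn hα hm1 hmn hθ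
      hρ hρθ hΩ hΩb ha hab hf hu
  · intro hmn θ hθ _ r hr hrθ β _ Ω hΩ hΩb a ha hab f hf u hu
    exact DegenerateElliptic.memWeakL_mul_log_of_lt_half_dim hn hα hm1 hmn hθ hr hrθ hΩ hΩb ha hab
      hf hu
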